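/- **Definitions.** A colored string is a string $S=S[1,n]$ with a color $f(p)$ for every position $p\in\{1,\dots,n\}$. Let $y$ be a color and $d\ge 0$ an integer. A substring $T$ of $S$ (possibly empty; the empty string occurs at $1,\dots,n+1$) is *$(y,d)$-unique* if for every occurrence $i$ of $T$, with $e=i+|T|-1$ its end position, $f(e+d)=y$ or $e+d>n$ (position $0$ has no color). It is *minimally $(y,d)$-unique* if it is $(y,d)$-unique and no proper, possibly empty, substring $U=T[i,j]$ of $T$ is $(y,d+|T|-j)$-unique. Let $\mathcal T$ be the suffix tree of $S^{\mathrm{rev}}\$$ and $L(u)$ the string represented by a node $u$. Number the $k$ nodes by $iBFS(u)=k-r(u)$, where $r(u)$ is the rank of $u$ in a breadth-first traversal (or any listing of the nodes by nondecreasing depth). For a node $u$ with parent $v$ such that the label of the edge $(v,u)$ is not $\$$, let $\mathrm{Left\text{-}min}(u)=x_1L(v)^{\mathrm{rev}}$, where $x_1$ is the first character of the label, and let $u'$ be the node at or directly below the locus of the string obtained from $L(v)x_1$ by deleting its first character. **Algorithm Skipping**, for $S$ and $y$. Let $b_y[1,2n]$ be the bitvector with $b_y[p]=1$ iff $f(p)=y$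 or $p>n$, preprocessed for $\mathrm{rank}(p)=\#\{q<p: b_y[q]=1\}$ and $\mathrm{select}(r)$, the position of the $r$-th one ($\mathrm{select}(0)=-1$). Insert all nodes with key $n+1$ into an indexed max-priority queue, with index $iBFS$ and ties broken in favor of the larger index. While some key is nonnegative: 1. let $(u,d)$ be the node of maximum key together with its key; 2. if $\mathrm{Left\text{-}min}(u)$ is defined and $u'$ was not extracted with key $d+1$, output $(\mathrm{Left\text{-}min}(u),d)$; record that $u$ was extracted with key $d$; 3. compute $m=h(u,d)$ by the recursion $h(u,\ell)=\max\{\mathrm{select}(\mathrm{rank}(j+\ell))-j,\,-1\}$ if $u$ is the leaf for the prefix of $S$ of length $j$, and $h(u,\ell)=\min(\{\ell-1\}\cup\{h(v,\ell): v\text{ child of }u\})$ if $u$ is an inner node; demote every node visited by the recursion to its value; 4. going from the parent of $u$ up to the root, demote every ancestor with key $>m$ to $m$. Step 4 may either visit all ancestors of $u$, or stop at the first ancestor whose key is $\le m$. **Cost model.** The suffix tree with its suffix links is given. Following a pointer in it, an array access, an arithmetic operation or comparison, and reporting a pair (by reference to its locus) take one step. The queue is implemented by a tournament tree, so that `insert`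 and `demote` take $O(\log k)$ steps and `max`, `keyOf` and `allNegative` take $O(1)$ steps. The preprocessing of $b_y$ and the insertions are part of the running time. **Theorem.** There is an absolute constant $C$ such that for every colored string $S$ and every color $y$, and for both versions of step 4, the algorithm terminates, and * the pairs that it outputs are exactly the pairs $(T,d)$ with $0\le d\le n$ such that $T$ is a nonempty minimally $(y,d)$-unique substring of $S$; * every node's key is demoted at most $n+2$ times; * if $n\ge 2$, the number of steps, not counting the visits of step 4 to ancestors that are not demoted, is at most $C\,n^2\log n$; * if $n\ge 2$ and step 4 stops at the first ancestor whose key is $\le m$, the total number of steps is at most $C\,n^2\log n$. -/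

import Mathlib

namespace ColoredStrings

universe u v

/-! Colored strings, `(y,d)`-uniqueness and minimality. All positions are 1-based. -/

/-- A colored string: a string together with a color for each of its positions. -/
structure ColoredString (α : Type u) (γ : Type v) where
  str : List α
  color : Fin str.length → γ

section Strings

variable {α : Type u} {γ : Type v}

/-- The length `n` of the string. -/
def ColoredString.len (S : ColoredString α γ) : ℕ := S.str.length

/-- The color `f(p)` of position `p`; there is none outside `1, …, n`. -/
def ColoredString.colorAt (S : ColoredString α γ) (p : ℕ) : Option γ :=
  if h : 1 ≤ p ∧ p - 1 < S.str.length then some (S.color ⟨p - 1, h.2⟩) else none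

/-- `T` occurs in `S` at position `i`. The empty string occurs at `1, …, n + 1`. -/
def IsOcc (S : ColoredString α γ) (T : List α) (i : ℕ) : Prop :=
  1 ≤ i ∧ i + T.length ≤ S.len + 1 ∧ (S.str.drop (i - 1)).take T.length = T

/-- The occurrence `i` of `T` is `y`-good with delay `d`: `f(i + |T| - 1 + d) = y`. -/
def IsGood (S : ColoredString α γ) (y : γ) (d : ℕ) (T : List α) (i : ℕ) : Prop :=
  S.colorAt (i + T.length - 1 + d) = some y

/-- `T` is a `y`-unique substring of `S` with delay `d`. -/
def IsUnique (S : ColoredString α γ) (y : γ) (d : ℕ) (T : List α) : Prop :=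
  T <:+: S.str ∧
    ∀ i, IsOcc S T i → IsGood S y d T i ∨ S.len < i + T.length - 1 + d

/-- `T` is minimally `(y,d)`-unique: it is `(y,d)`-unique, and no proper substring `U = T[i..j]`
of it (the rest of `T` to the right of `U` being `B`, so `|B| = |T| - j`) is `y`-unique with
delay `d + |T| - j`. -/
def IsMinUnique (S : ColoredString α γ) (y : γ) (d : ℕ) (T : List α) : Prop :=
  IsUnique S y d T ∧
    ∀ A U B : List α, T = A ++ U ++ B → U ≠ T → ¬ IsUnique S y (d + B.length) U

end Strings

/-! The suffix tree of the reversed string. A node is identified with the string `L(u)` that it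
represents; `none` plays the role of the end marker `$`. -/

section SuffixTree

/-- Nodes (and loci) of the suffix tree, as strings over the alphabet extended by `$ = none`. -/
abbrev Node (α : Type u) := List (Option α)

variable {α : Type u} {γ : Type v} [DecidableEq α]

/-- The string `S^rev $`. -/
def text (S : ColoredString α γ) : Node α := S.str.reverse.map some ++ [none]

/-- The leaves: the nonempty suffixes of `S^rev $`. -/
def IsLeaf (S : ColoredString α γ) (u : Node α) : Prop := u ≠ [] ∧ u <:+ text S

instance (S : ColoredString α γ) (u : Node α) : Decidable (IsLeaf S u) :=
  inferInstanceAs (Decidable (_ ∧ _))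

/-- The nodes: the root, the leaves, and the right-branching substrings of `S^rev $`. -/
def IsNode (S : ColoredString α γ) (u : Node α) : Prop :=
  u = [] ∨ IsLeaf S u ∨
    ∃ a ∈ text S, ∃ b ∈ text S, a ≠ b ∧ u ++ [a] <:+: text S ∧ u ++ [b] <:+: text S

instance (S : ColoredString α γ) (u : Node α) : Decidable (IsNode S u) :=
  inferInstanceAs (Decidable (_ ∨ _ ∨ _))

/-- The leaf number: the starting position of the suffix `u` in `S^rev $`. -/
def leafNumber (S : ColoredString α γ) (u : Node α) : ℕ := S.len + 2 - u.length

/-- The proper ancestors of `u`, from its parent up to the root. -/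
def ancestors (S : ColoredString α γ) (u : Node α) : List (Node α) :=
  (u.inits.dropLast.filter fun v => decide (IsNode S v)).reverse

/-- The parent; the root has none. -/
def parent (S : ColoredString α γ) (u : Node α) : Option (Node α) := (ancestors S u).head?

/-- The treedepth. -/
def treeDepth (S : ColoredString α γ) (u : Node α) : ℕ := (ancestors S u).length

/-- `ord` lists every node of the suffix tree exactly once, by nondecreasing treedepth. Every
breadth-first traversal does so. -/
structure IsLevelOrder (S : ColoredString α γ) (ord : List (Node α)) : Prop where
  nodup : ord.Nodup
  mem_iff : ∀ u, u ∈ ord ↔ IsNode S u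
  sorted : ord.Pairwise fun u v => treeDepth S u ≤ treeDepth S v

/-- The children of `u`, in the order of the traversal. -/
def children (S : ColoredString α γ) (ord : List (Node α)) (u : Node α) : List (Node α) :=
  ord.filter fun v => decide (parent S v = some u)

/-- The node `u` of the locus `(u,t)` of the string `X`, where `t = |X|`: `X` is a prefix
of `L(u)` but not of `L(parent u)`. -/
def locusNode (S : ColoredString α γ) (ord : List (Node α)) (X : Node α) : Node α :=
  (ord.find? fun u => decide (X <+: u ∧ ∀ p ∈ ancestors S u, p.length < X.length)).getD []

/-- The node `u'` with `(u',t') = slink(u, sd(v) + 1)`, where `v` is the parent of `u`. -/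
def slinkNode (S : ColoredString α γ) (ord : List (Node α)) (u v : Node α) : Node α :=
  locusNode S ord (u.take (v.length + 1)).tail

/-- `Left-min(u) = x₁ · L(v)^rev`, where `v` is the parent of `u` and `x₁` is the first character
of the label of the edge `(v,u)`. It is undefined for the root and for an edge labeled `$`. -/
def leftMin (S : ColoredString α γ) (u : Node α) : Option (List α) :=
  match parent S u with
  | none => none
  | some v => if u = v ++ [none] then none else some (u.take (v.length + 1)).reverse.reduceOption

/-- The reverse breadth-first index of `u`: the number of nodes minus the (1-based) rank. -/
def iBFS (ord : List (Node α)) (u : Node α) : ℕ := ord.length - (ord.idxOf u + 1)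

/-- The node with a given reverse breadth-first index. -/
def nodeOf (ord : List (Node α)) (i : ℕ) : Node α := (ord[ord.length - (i + 1)]?).getD []

/-- Level orders exist. -/
theorem exists_isLevelOrder (S : ColoredString α γ) : ∃ ord, IsLevelOrder S ord := by
  classical
  have hfin : {u | IsNode S u}.Finite := by
    refine (List.finite_toSet (text S).sublists).subset fun u hu => ?_
    have : u <:+: text S := by
      rcases hu with h | h | ⟨a, -, b, -, -, h, -⟩
      · exact h ▸ List.nil_infix
      · exact h.2.isInfix
      · exact ((List.prefix_append u [a]).isInfix).trans h
    exact List.mem_sublists.2 this.sublist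
  let le : Node α → Node α → Bool := fun u v => decide (treeDepth S u ≤ treeDepth S v)
  refine ⟨hfin.toFinset.toList.mergeSort le, ?_, fun u => ?_, ?_⟩
  · exact (List.mergeSort_perm _ _).nodup_iff.2 (Finset.nodup_toList _)
  · simp
  · have := List.pairwise_mergeSort (le := le)
      (fun a b c h1 h2 => by simp only [le, decide_eq_true_eq] at *; omega)
      (fun a b => by simp only [le, Bool.or_eq_true, decide_eq_true_eq]; omega)
      hfin.toFinset.toList
    exact this.imp fun h => by simpa [le] using h

end SuffixTree

/-! The algorithm. It runs on a store of arrays (functions on indices, changed one entry at a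
time). The suffix tree with its suffix links is given: following a pointer from a node to its
index, parent, next child, leaf number or suffix link, reading or writing an array entry, an
arithmetic operation or comparison, and reporting a pair (as a reference to the locus of its
string) are elementary operations. Each `tick` pays for a bounded number of them. -/

section Algorithm

/-- The store. -/
structure Store (α : Type u) where
  /-- priority queue: the key of each index -/
  key : ℕ → ℤ
  /-- priority queue: a tournament tree with root `1`, where `2 * x` and `2 * x + 1` are below `x`;
  it holds at `x` the index with the largest key among the indices inserted below `x` -/
  win : ℕ → Option ℕ
  /-- number of ones of the bitvector strictly before a position -/
  rank : ℕ → ℕ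
  /-- position of the `r`-th one of the bitvector; entry `0` holds `-1` -/
  select : ℕ → ℤ
  /-- number of ones met so far in the preprocessing of the bitvector -/
  ones : ℕ
  /-- for each parity, the last `d` of this parity for which the node was extracted -/
  leftMinimal : ℕ → ℕ → Option ℕ
  /-- the reported pairs -/
  out : List (List α × ℕ)
  /-- number of `demote` operations on each index -/
  demotes : ℕ → ℕ
  /-- number of ancestors that were visited without being demoted -/
  idle : ℕ
  /-- number of steps -/
  time : ℕ

variable {α : Type u} {γ : Type v}

/-- The store before the start. -/
def Store.empty : Store α where
  key := fun _ => 0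
  win := fun _ => none
  rank := fun _ => 0
  select := fun _ => -1
  ones := 0
  leftMinimal := fun _ _ => none
  out := []
  demotes := fun _ => 0
  idle := 0
  time := 0

/-- Pay for one step. -/
def Store.tick (s : Store α) : Store α := { s with time := s.time + 1 }

/-! Maximum-oriented indexed priority queue with `2 ^ L` indices; ties are broken in favor of the
larger index. -/

/-- The winner among two entries of the tournament tree. -/
def better (key : ℕ → ℤ) : Option ℕ → Option ℕ → Option ℕ
  | none, b => b
  | a, none => a
  | some i, some j => if key i < key j ∨ (key i = key j ∧ i < j) then some j else some i

/-- Recompute `l` entries of the tournament tree, from `x` upwards. -/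
def Store.climb : ℕ → ℕ → Store α → Store α
  | 0, _, s => s
  | l + 1, x, s =>
    Store.climb l (x / 2)
      { s.tick with win := Function.update s.win x (better s.key (s.win (2 * x)) (s.win (2 * x + 1))) }

/-- Give index `i` the key `k`. -/
def Store.setKey (L i : ℕ) (k : ℤ) (s : Store α) : Store α :=
  Store.climb L ((2 ^ L + i) / 2)
    { s.tick with
      key := Function.update s.key i k
      win := Function.update s.win (2 ^ L + i) (some i) }

/-- `insert(i,k)` -/
def Store.insert (L i : ℕ) (k : ℤ) (s : Store α) : Store α := s.setKey L i k

/-- `demote(i,k)` -/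
def Store.demote (L i : ℕ) (k : ℤ) (s : Store α) : Store α :=
  { s.setKey L i k with demotes := Function.update s.demotes i (s.demotes i + 1) }

/-- `max()`: the index and the value of the largest key. -/
def Store.max (s : Store α) : Option (ℕ × ℤ) := (s.win 1).map fun i => (i, s.key i)

/-- `allNegative()` -/
def Store.allNegative (s : Store α) : Bool :=
  match s.max with
  | none => true
  | some (_, k) => decide (k < 0)

/-! The bitvector `b_y[1..2n]` with tables for rank and select. -/

/-- `b_y[p] = 1` iff position `p` has color `y` or lies beyond the end of the string. -/
def bit [DecidableEq γ] (S : ColoredString α γ) (y : γ) (p : ℕ) : Bool :=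
  decide (S.colorAt p = some y ∨ S.len < p)

/-- Fill the tables for position `p`, after all smaller positions. -/
def Store.scan [DecidableEq γ] (S : ColoredString α γ) (y : γ) (s : Store α) (p : ℕ) : Store α :=
  if bit S y p then
    { s.tick with
      ones := s.ones + 1
      select := Function.update s.select (s.ones + 1) (p : ℤ)
      rank := Function.update s.rank (p + 1) (s.ones + 1) }
  else
    { s.tick with rank := Function.update s.rank (p + 1) s.ones }

/-- Preprocess the bitvector. -/
def Store.preprocess [DecidableEq γ] (S : ColoredString α γ) (y : γ) (s : Store α) : Store α :=
  (List.range (2 * S.len)).foldl (fun s q => Store.scan S y s (q + 1)) s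

variable [DecidableEq α]

/-- The number of levels of the tournament tree. -/
def levels (ord : List (Node α)) : ℕ := Nat.clog 2 ord.length

/-- The recursive procedure `h(u,ℓ)`: it returns its value and demotes the key of every node in the
subtree of `u` to the value at that node. The first argument bounds the depth of the recursion;
`n + 2` exceeds the height of the suffix tree. -/
def hProc (S : ColoredString α γ) (ord : List (Node α)) :
    ℕ → Node α → ℕ → Store α → ℤ × Store α
  | 0, _, ℓ, s => ((ℓ : ℤ) - 1, s)
  | depth + 1, u, ℓ, s =>
    if IsLeaf S u then
      let j := S.len + 1 - leafNumber S u
      let m := max (s.select (s.rank (j + ℓ)) - (j : ℤ)) (-1)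
      (m, s.tick.demote (levels ord) (iBFS ord u) m)
    else
      let r := (children S ord u).foldl
        (fun (a : ℤ × Store α) v =>
          let b := hProc S ord depth v ℓ a.2.tick
          (if b.1 < a.1 then b.1 else a.1, b.2))
        ((ℓ : ℤ) - 1, s.tick)
      (r.1, r.2.demote (levels ord) (iBFS ord u) r.1)

/-- The loop over the given ancestors, from the parent upwards: those with a key larger than `m`
are demoted to `m`. If `brk` holds, the loop is left at the first ancestor with a key `≤ m`;
otherwise all ancestors are visited. -/
def updateAncestors (ord : List (Node α)) (brk : Bool) (m : ℤ) :
    List (Node α) → Store α → Store α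
  | [], s => s
  | v :: vs, s =>
    if m < s.key (iBFS ord v) then
      updateAncestors ord brk m vs (s.tick.demote (levels ord) (iBFS ord v) m)
    else
      let s' := { s.tick with idle := s.idle + 1 }
      if brk then s' else updateAncestors ord brk m vs s'

/-- Right-minimality check and output for the extracted node `u` and the delay `d`. The check
reads off whether `u'` was extracted with key `d + 1`. -/
def report (S : ColoredString α γ) (ord : List (Node α)) (u : Node α) (d : ℕ) (s : Store α) :
    Store α :=
  match parent S u, leftMin S u with
  | some v, some T =>
    if s.leftMinimal ((d + 1) % 2) (iBFS ord (slinkNode S ord u v)) = some (d + 1) then s.tick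
    else { s.tick with out := (T, d) :: s.out }
  | _, _ => s.tick

/-- Record that `u` was extracted with key `d`. -/
def record (ord : List (Node α)) (u : Node α) (d : ℕ) (s : Store α) : Store α :=
  { s.tick with
    leftMinimal := Function.update s.leftMinimal (d % 2)
      (Function.update (s.leftMinimal (d % 2)) (iBFS ord u) (some d)) }

/-- One iteration of the main loop. -/
def iteration (S : ColoredString α γ) (ord : List (Node α)) (brk : Bool) (s : Store α) : Store α :=
  match s.max with
  | none => s
  | some (i, k) =>
    let u := nodeOf ord i
    let d := k.toNat
    let r := hProc S ord (S.len + 2) u d (record ord u d (report S ord u d s.tick))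
    updateAncestors ord brk r.1 (ancestors S u) r.2

/-- `While S ord brk s t`: the main loop, started in the store `s`, terminates in the store `t`. -/
inductive While (S : ColoredString α γ) (ord : List (Node α)) (brk : Bool) :
    Store α → Store α → Prop
  | done (s : Store α) : s.allNegative = true → While S ord brk s s.tick
  | next (s t : Store α) : s.allNegative = false →
      While S ord brk (iteration S ord brk s.tick) t → While S ord brk s t

/-- The initialization: the bitvector is preprocessed, and every node is inserted with key
`n + 1`. -/
def start [DecidableEq γ] (S : ColoredString α γ) (y : γ) (ord : List (Node α)) : Store α :=
  ord.foldl (fun s u => s.tick.insert (levels ord) (iBFS ord u) ((S.len : ℤ) + 1))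
    (Store.preprocess S y Store.empty)

/-- The skipping algorithm for the colored string `S` and the color `y`, on the suffix tree of
`S^rev` with the nodes numbered along `ord`, terminates in the store `t`. -/
def SkippingEndsIn [DecidableEq γ] (S : ColoredString α γ) (y : γ) (ord : List (Node α))
    (brk : Bool) (t : Store α) : Prop :=
  While S ord brk (start S y ord) t

end Algorithm

end ColoredStrings

/-!
A string `T` is `(y,d)`-unique iff `b_y` has a one at distance `d` behind every leaf below the
locus of `T^rev`, so it suffices to decide this for the node at or directly below the locus.
Extending `T` to the right only means decreasing `d`, and extending it to the left means descending
in the tree. Hence a nonempty `T` is minimally `(y,d)`-unique iff it is `Left-min(u)` for a node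
`u` such that `u` is `(y,d)`-unique, no proper ancestor of `u` is, and the node `u'` reached by the
suffix link does not have these two properties with `d + 1`.

Call such a `u` left-minimal for `d` when the first two properties hold. Extracting `u` with key
`d` lowers the keys below `u` to the largest smaller delays that are possible at their leaves, so
the keys never jump over a delay for which a node is unique. As the keys increase towards the
leaves and ties are broken in favor of ancestors, the extracted pairs are exactly the left-minimal
ones. They are extracted in the order of decreasing `d`, so that the left-minimality of `u'` for
`d + 1` has been decided by the time `u` is extracted with key `d`.

For the running time, the keys of all nodes below an extracted `u` equal `d` and strictly decrease,
so every step except the idle visits is paid for by a demotion. A key takes values between `n + 1`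
and `-1`, the tree has `O(n)` nodes, and a demotion takes `O(log n)` steps.
-/

namespace ColoredStrings

/-! ### The suffix tree -/

section Lists

variable {β : Type*}

theorem infix_dropLast_of_append_infix {X t l : List β} (h : X ++ t <:+: l) (ht : t ≠ []) :
    X <:+: l.dropLast := by
  obtain ⟨p, q, rfl⟩ := h
  have hne : t ++ q ≠ [] := by simp [ht]
  refine ⟨p, (t ++ q).dropLast, ?_⟩
  rw [← List.dropLast_append_of_ne_nil hne]
  simp only [List.append_assoc]

theorem exists_branching_prefix : ∀ u w : List β, ¬ u <+: w → ¬ w <+: u →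
    ∃ (z : List β) (a b : β), a ≠ b ∧ z ++ [a] <+: u ∧ z ++ [b] <+: w
  | [], w, h, _ => absurd List.nil_prefix h
  | u, [], _, h => absurd List.nil_prefix h
  | a :: u, b :: w, h1, h2 => by
    by_cases hab : a = b
    · subst hab
      obtain ⟨z, c, d, hcd, hc, hd⟩ := exists_branching_prefix u w
        (fun h => h1 (by simpa using h)) (fun h => h2 (by simpa using h))
      exact ⟨a :: z, c, d, hcd, by simpa using hc, by simpa using hd⟩
    · exact ⟨[], a, b, hab, by simp, by simp⟩

theorem length_lt_of_prefix_of_ne {u w : List β} (h : u <+: w) (hne : u ≠ w) :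
    u.length < w.length :=
  h.length_le.lt_of_ne fun hl => hne (h.eq_of_length hl)

theorem inits_dropLast (u : List β) :
    u.inits.dropLast = (List.range u.length).map fun k => u.take k :=
  List.ext_getElem (by simp) fun k _ _ => by simp [List.getElem_inits]

theorem mem_inits_dropLast {p u : List β} : p ∈ u.inits.dropLast ↔ p <+: u ∧ p ≠ u := by
  simp only [inits_dropLast, List.mem_map, List.mem_range]
  constructor
  · rintro ⟨k, hk, rfl⟩
    refine ⟨List.take_prefix k u, fun h => ?_⟩
    have := congrArg List.length h
    simp only [List.length_take] at this
    omega
  · rintro ⟨h, hne⟩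
    exact ⟨p.length, length_lt_of_prefix_of_ne h hne, (List.prefix_iff_eq_take.1 h).symm⟩

theorem pairwise_inits_dropLast (u : List β) :
    u.inits.dropLast.Pairwise fun p q => p <+: q ∧ p ≠ q := by
  rw [inits_dropLast, List.pairwise_map]
  refine List.pairwise_lt_range.imp_of_mem fun {j k} hj hk hjk => ?_
  rw [List.mem_range] at hj hk
  refine ⟨List.take_prefix_take_left hjk.le, fun h => ?_⟩
  have := congrArg List.length h
  simp only [List.length_take] at this
  omega

end Lists

section Nodes

variable {α γ : Type*} {S : ColoredString α γ} {u v w X : Node α}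

/-- The locus of a string `T`: the string `T^rev` over the alphabet extended by `$`. -/
def revLocus (T : List α) : Node α := T.reverse.map some

theorem length_revLocus (T : List α) : (revLocus T).length = T.length := by simp [revLocus]

theorem revLocus_append (A B : List α) : revLocus (A ++ B) = revLocus B ++ revLocus A := by
  simp [revLocus]

theorem dropLast_revLocus (T : List α) : (revLocus T).dropLast = revLocus T.tail := by
  rw [revLocus, revLocus, ← List.map_dropLast, List.dropLast_reverse]

theorem tail_revLocus (T : List α) : (revLocus T).tail = revLocus T.dropLast := by
  rw [revLocus, revLocus, ← List.map_tail, List.tail_reverse]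

theorem none_notMem_revLocus (T : List α) : none ∉ revLocus T := by simp [revLocus]

theorem revLocus_ne_nil {T : List α} : revLocus T ≠ [] ↔ T ≠ [] := by simp [revLocus]

theorem revLocus_injective : Function.Injective (revLocus : List α → Node α) :=
  (List.map_injective_iff.2 (Option.some_injective α)).comp List.reverse_injective

theorem text_eq (S : ColoredString α γ) : text S = revLocus S.str ++ [none] := rfl

theorem dropLast_text (S : ColoredString α γ) : (text S).dropLast = revLocus S.str :=
  List.dropLast_concat

theorem length_text (S : ColoredString α γ) : (text S).length = S.len + 1 := by
  simp [text, ColoredString.len]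

theorem revLocus_infix_iff {T T' : List α} : revLocus T <:+: revLocus T' ↔ T <:+: T' := by
  refine ⟨fun h => ?_, fun h => (List.reverse_infix.2 h).map some⟩
  obtain ⟨Z, hZ, hTZ⟩ := List.infix_map_iff.1 h
  rwa [← List.map_injective_iff.2 (Option.some_injective α) hTZ, List.reverse_infix] at hZ

theorem revLocus_prefix_iff {T T' : List α} : revLocus T <+: revLocus T' ↔ T <:+ T' := by
  rw [revLocus, revLocus, List.prefix_map_iff_of_injective (Option.some_injective α),
    List.reverse_prefix]

theorem exists_eq_revLocus {T : List α} (h : X <:+: revLocus T) : ∃ Z, X = revLocus Z := by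
  obtain ⟨Z, -, rfl⟩ := List.infix_map_iff.1 h
  exact ⟨Z.reverse, by simp [revLocus]⟩

theorem isLeaf_iff :
    IsLeaf S w ↔ ∃ j ≤ S.len, w = revLocus (S.str.take j) ++ [none] := by
  rw [IsLeaf, text_eq, List.suffix_concat_iff]
  constructor
  · rintro ⟨h0, h | ⟨t, rfl, ht⟩⟩
    · exact absurd h h0
    · obtain ⟨T, rfl⟩ := exists_eq_revLocus ht.isInfix
      have hT : T <+: S.str := by
        rwa [revLocus, revLocus, List.suffix_map_iff_of_injective (Option.some_injective α),
          List.reverse_suffix] at ht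
      exact ⟨T.length, hT.length_le, by rw [← List.prefix_iff_eq_take.1 hT]⟩
  · rintro ⟨j, -, rfl⟩
    exact ⟨by simp, Or.inr ⟨_, rfl, (List.reverse_suffix.2 (List.take_prefix _ _)).map some⟩⟩

theorem IsLeaf.length_le (h : IsLeaf S w) : w.length ≤ S.len + 1 :=
  h.2.length_le.trans_eq (length_text S)

theorem IsLeaf.length_pos (h : IsLeaf S w) : 0 < w.length := List.length_pos_iff.2 h.1

theorem IsLeaf.of_cons {a : α} {w : Node α} (h : IsLeaf S (some a :: w)) : IsLeaf S w := by
  refine ⟨?_, (List.suffix_cons (some a) w).trans h.2⟩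
  rintro rfl
  obtain ⟨j, -, hj⟩ := isLeaf_iff.1 h
  simpa using congrArg List.getLast? hj

theorem IsLeaf.isNode (h : IsLeaf S w) : IsNode S w := Or.inr (Or.inl h)

theorem isNode_nil : IsNode S [] := Or.inl rfl

theorem isNode_of_branching {a b : Option α} (hab : a ≠ b) (ha : u ++ [a] <:+: text S)
    (hb : u ++ [b] <:+: text S) : IsNode S u :=
  Or.inr (Or.inr ⟨a, ha.subset (by simp), b, hb.subset (by simp), hab, ha, hb⟩)

theorem IsNode.infix_text (h : IsNode S w) : w <:+: text S := by
  rcases h with rfl | h | ⟨a, -, b, -, -, h, -⟩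
  · exact List.nil_infix
  · exact h.2.isInfix
  · exact (List.prefix_append w [a]).isInfix.trans h

theorem IsNode.length_le (h : IsNode S w) : w.length ≤ S.len + 1 :=
  h.infix_text.length_le.trans_eq (length_text S)

theorem IsLeaf.eq_of_prefix (h : IsLeaf S w) (hv : v <:+: text S) (hp : w <+: v) : v = w := by
  obtain ⟨t, rfl⟩ := hp
  rcases eq_or_ne t [] with rfl | ht
  · exact List.append_nil w
  · obtain ⟨j, -, rfl⟩ := isLeaf_iff.1 h
    have hinfix := infix_dropLast_of_append_infix hv ht
    rw [dropLast_text] at hinfix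
    exact (none_notMem_revLocus _ (hinfix.subset (by simp))).elim

theorem exists_isLeaf_of_infix (h : X <:+: text S) : ∃ w, IsLeaf S w ∧ X <+: w := by
  obtain ⟨p, q, h⟩ := h
  by_cases hX : X = []
  · subst hX
    exact ⟨text S, ⟨by simp [text], List.suffix_refl _⟩, List.nil_prefix⟩
  · exact ⟨X ++ q, ⟨by simp [hX], p, by rw [← h, List.append_assoc]⟩, List.prefix_append _ _⟩

/-- `u` is the node at or directly below the locus of the string `X`: among the nodes with
prefix `X` it is the highest. -/
structure IsLocus (S : ColoredString α γ) (X u : Node α) : Prop where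
  isNode : IsNode S u
  isPrefix : X <+: u
  length_lt : ∀ p, IsNode S p → p <+: u → p ≠ u → p.length < X.length

theorem IsLocus.prefix_isLeaf (h : IsLocus S X u) (hw : IsLeaf S w) (hX : X <+: w) :
    u <+: w := by
  by_contra hu
  by_cases hwu : w <+: u
  · exact hu (hw.eq_of_prefix h.isNode.infix_text hwu ▸ List.prefix_rfl)
  obtain ⟨z, a, b, hab, ha, hb⟩ := exists_branching_prefix u w hu hwu
  have hz : IsNode S z := isNode_of_branching hab (ha.isInfix.trans h.isNode.infix_text)
    (hb.isInfix.trans hw.2.isInfix)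
  have hlt : z.length < X.length := by
    refine h.length_lt z hz ((List.prefix_append z [a]).trans ha) ?_
    rintro rfl
    simpa using ha.length_le
  have haX : z ++ [a] <+: X := List.prefix_of_prefix_length_le ha h.isPrefix (by simpa using hlt)
  have hza : z ++ [a] <+: z ++ [b] := List.prefix_of_prefix_length_le (haX.trans hX) hb (by simp)
  exact hab (by simpa using hza.eq_of_length (by simp))

theorem exists_isLocus (h : X <:+: text S) : ∃ u, IsLocus S X u := by
  classical
  obtain ⟨w, hw, hX⟩ := exists_isLeaf_of_infix h
  have hex : ∃ n, ∃ u, IsNode S u ∧ X <+: u ∧ u.length = n := ⟨_, w, hw.isNode, hX, rfl⟩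
  obtain ⟨u, hu, hXu, hl⟩ := Nat.find_spec hex
  refine ⟨u, hu, hXu, fun p hp hpu hne => ?_⟩
  by_contra hlt
  have hXp : X <+: p := List.prefix_of_prefix_length_le hXu hpu (not_lt.1 hlt)
  have hmin := Nat.find_min' hex ⟨p, hp, hXp, rfl⟩
  rw [← hl] at hmin
  exact hne (hpu.eq_of_length_le hmin)

theorem nodeOf_eq_getElem {ord : List (Node α)} {i : ℕ} (h : i < ord.length) :
    nodeOf ord i = ord[ord.length - (i + 1)] := by
  simp [nodeOf, List.getElem?_eq_getElem (show ord.length - (i + 1) < ord.length by omega)]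

theorem nodeOf_mem {ord : List (Node α)} {i : ℕ} (h : i < ord.length) : nodeOf ord i ∈ ord :=
  nodeOf_eq_getElem h ▸ List.getElem_mem _

end Nodes

section Tree

variable {α γ : Type*} [DecidableEq α] {S : ColoredString α γ} {ord : List (Node α)}
  {p u v w X : Node α}

theorem mem_ancestors : p ∈ ancestors S u ↔ IsNode S p ∧ p <+: u ∧ p ≠ u := by
  simp only [ancestors, List.mem_reverse, List.mem_filter, mem_inits_dropLast, decide_eq_true_eq]
  exact and_comm

theorem pairwise_ancestors (S : ColoredString α γ) (u : Node α) :
    (ancestors S u).Pairwise fun p q => q <+: p ∧ q ≠ p :=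
  List.pairwise_reverse.2 ((pairwise_inits_dropLast u).filter _)

theorem treeDepth_lt (hw : IsNode S w) (h : w <+: u) (hne : w ≠ u) :
    treeDepth S w < treeDepth S u := by
  have hnodup : (w :: ancestors S w).Nodup :=
    List.nodup_cons.2 ⟨fun h => (mem_ancestors.1 h).2.2 rfl,
      (pairwise_ancestors S w).imp fun h => h.2.symm⟩
  have hsub : w :: ancestors S w ⊆ ancestors S u := by
    refine List.cons_subset.2 ⟨mem_ancestors.2 ⟨hw, h, hne⟩, fun p hp => ?_⟩
    obtain ⟨hpn, hpw, hpne⟩ := mem_ancestors.1 hp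
    refine mem_ancestors.2 ⟨hpn, hpw.trans h, ?_⟩
    rintro rfl
    exact hpne (hpw.eq_of_length_le h.length_le)
  exact (hnodup.subperm hsub).length_le

theorem parent_eq_some :
    parent S u = some v ↔ (IsNode S v ∧ v <+: u ∧ v ≠ u) ∧
      ∀ p, IsNode S p → p <+: u → p ≠ u → p <+: v := by
  have hsorted := pairwise_ancestors S u
  have hmem : ∀ {p}, p ∈ ancestors S u ↔ IsNode S p ∧ p <+: u ∧ p ≠ u := mem_ancestors
  unfold parent
  cases h : ancestors S u with
  | nil =>
    simp only [List.head?_nil, reduceCtorEq, false_iff]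
    rintro ⟨hv, -⟩
    simpa [h] using hmem.2 hv
  | cons a l =>
    rw [h] at hsorted hmem
    rw [List.pairwise_cons] at hsorted
    simp only [List.head?_cons, Option.some.injEq]
    constructor
    · rintro rfl
      refine ⟨hmem.1 (by simp), fun p h1 h2 h3 => ?_⟩
      rcases List.mem_cons.1 (hmem.2 ⟨h1, h2, h3⟩) with rfl | hp
      · exact List.prefix_rfl
      · exact (hsorted.1 p hp).1
    · rintro ⟨hv, hmax⟩
      rcases List.mem_cons.1 (hmem.2 hv) with rfl | hvl
      · rfl
      · obtain ⟨ha, hau, hane⟩ := hmem.1 (List.mem_cons_self (a := a) (l := l))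
        exact (hmax a ha hau hane).eq_of_length_le (hsorted.1 v hvl).1.length_le

theorem ne_nil_of_parent_eq_some (h : parent S u = some v) : u ≠ [] := by
  rintro rfl
  obtain ⟨⟨-, hv, hne⟩, -⟩ := parent_eq_some.1 h
  exact hne (List.prefix_nil.1 hv)

theorem mem_children (ho : IsLevelOrder S ord) :
    v ∈ children S ord u ↔ IsNode S v ∧ parent S v = some u := by
  simp [children, ho.mem_iff]

theorem nodup_children (ho : IsLevelOrder S ord) (u : Node α) : (children S ord u).Nodup :=
  ho.nodup.filter _

theorem isNode_of_mem_children (ho : IsLevelOrder S ord) (h : v ∈ children S ord u) :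
    IsNode S v :=
  ((mem_children ho).1 h).1

theorem prefix_of_mem_children (ho : IsLevelOrder S ord) (h : v ∈ children S ord u) : u <+: v :=
  (parent_eq_some.1 ((mem_children ho).1 h).2).1.2.1

theorem ne_of_mem_children (ho : IsLevelOrder S ord) (h : v ∈ children S ord u) : u ≠ v :=
  (parent_eq_some.1 ((mem_children ho).1 h).2).1.2.2

theorem exists_mem_children_prefix (ho : IsLevelOrder S ord) (hu : IsNode S u)
    (hw : IsNode S w) (h : u <+: w) (hne : u ≠ w) : ∃ v ∈ children S ord u, v <+: w := by
  classical
  have hex : ∃ n, ∃ v, IsNode S v ∧ v <+: w ∧ u.length < v.length ∧ v.length = n :=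
    ⟨_, w, hw, List.prefix_rfl, length_lt_of_prefix_of_ne h hne, rfl⟩
  obtain ⟨v, hv, hvw, hlt, hl⟩ := Nat.find_spec hex
  refine ⟨v, (mem_children ho).2 ⟨hv, parent_eq_some.2 ⟨⟨hu, ?_, ?_⟩, fun p hp hpv hpn => ?_⟩⟩, hvw⟩
  · exact List.prefix_of_prefix_length_le h hvw hlt.le
  · rintro rfl
    exact hlt.false
  · refine List.prefix_of_prefix_length_le (hpv.trans hvw) h (not_lt.1 fun hlt' => ?_)
    have hmin := Nat.find_min' hex ⟨p, hp, hpv.trans hvw, hlt', rfl⟩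
    rw [← hl] at hmin
    exact hpn (hpv.eq_of_length_le hmin)

theorem eq_of_parent_eq_of_prefix (hv : IsNode S v) (hpv : parent S v = some u)
    (hpw : parent S w = some u) (h : v <+: w) : v = w := by
  by_contra hne
  obtain ⟨-, huv, huv'⟩ := (parent_eq_some.1 hpv).1
  exact huv' (huv.eq_of_length_le ((parent_eq_some.1 hpw).2 v hv h hne).length_le)

theorem eq_of_mem_children_of_prefix (ho : IsLevelOrder S ord) {v' : Node α}
    (h : v ∈ children S ord u) (h' : v' ∈ children S ord u) (hw : v <+: w) (hw' : v' <+: w) :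
    v = v' := by
  obtain ⟨hv, hpv⟩ := (mem_children ho).1 h
  obtain ⟨hv', hpv'⟩ := (mem_children ho).1 h'
  rcases List.prefix_or_prefix_of_prefix hw hw' with hvv' | hvv'
  · exact eq_of_parent_eq_of_prefix hv hpv hpv' hvv'
  · exact (eq_of_parent_eq_of_prefix hv' hpv' hpv hvv').symm

theorem isLocus_iff :
    IsLocus S X u ↔ IsNode S u ∧ X <+: u ∧ ∀ p ∈ ancestors S u, p.length < X.length := by
  simp only [mem_ancestors, and_imp]
  exact ⟨fun h => ⟨h.isNode, h.isPrefix, h.length_lt⟩, fun h => ⟨h.1, h.2.1, h.2.2⟩⟩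

theorem isLocus_locusNode (ho : IsLevelOrder S ord) (h : X <:+: text S) :
    IsLocus S X (locusNode S ord X) := by
  obtain ⟨u, hu⟩ := exists_isLocus h
  obtain ⟨w, hw⟩ : ∃ w, ord.find? (fun u => decide (X <+: u ∧
      ∀ p ∈ ancestors S u, p.length < X.length)) = some w :=
    Option.isSome_iff_exists.1 (List.find?_isSome.2
      ⟨u, (ho.mem_iff u).2 hu.isNode, decide_eq_true (isLocus_iff.1 hu).2⟩)
  rw [locusNode, hw]
  exact isLocus_iff.2
    ⟨(ho.mem_iff w).1 (List.mem_of_find?_eq_some hw), of_decide_eq_true (List.find?_some hw :)⟩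

theorem isNode_locusNode (ho : IsLevelOrder S ord) (X : Node α) :
    IsNode S (locusNode S ord X) := by
  unfold locusNode
  cases h : ord.find? fun u => decide (X <+: u ∧ ∀ p ∈ ancestors S u, p.length < X.length) with
  | none => exact isNode_nil
  | some w => exact (ho.mem_iff w).1 (List.mem_of_find?_eq_some h)

theorem iBFS_lt (h : u ∈ ord) : iBFS ord u < ord.length := by
  have := List.idxOf_lt_length_of_mem h
  unfold iBFS
  omega

theorem iBFS_inj (hu : u ∈ ord) (hw : w ∈ ord) (h : iBFS ord u = iBFS ord w) : u = w := by
  have := List.idxOf_lt_length_of_mem hu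
  have := List.idxOf_lt_length_of_mem hw
  unfold iBFS at h
  exact (List.idxOf_inj hu).1 (by omega)

theorem iBFS_nodeOf (ho : ord.Nodup) {i : ℕ} (h : i < ord.length) :
    iBFS ord (nodeOf ord i) = i := by
  rw [nodeOf_eq_getElem h, iBFS, ho.idxOf_getElem]
  omega

theorem iBFS_lt_of_prefix (ho : IsLevelOrder S ord) (hw : IsNode S w) (hu : IsNode S u)
    (h : w <+: u) (hne : w ≠ u) : iBFS ord u < iBFS ord w := by
  have hw' := List.idxOf_lt_length_of_mem ((ho.mem_iff w).2 hw)
  have hu' := List.idxOf_lt_length_of_mem ((ho.mem_iff u).2 hu)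
  have hdepth := treeDepth_lt hw h hne
  have hidx : ord.idxOf w < ord.idxOf u := by
    refine (lt_trichotomy (ord.idxOf w) (ord.idxOf u)).resolve_right ?_
    rintro (heq | hlt)
    · exact hne ((List.idxOf_inj ((ho.mem_iff w).2 hw)).1 heq)
    · have := List.pairwise_iff_getElem.1 ho.sorted _ _ hu' hw' hlt
      simp only [List.getElem_idxOf] at this
      omega
  unfold iBFS
  omega

end Tree

/-! ### Uniqueness in the suffix tree -/

section NodeUnique

variable {α γ : Type*} [DecidableEq γ] {S : ColoredString α γ} {y : γ} {d : ℕ} {X Y u v : Node α}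

/-- `(y,d)`-uniqueness of the string with locus `X`, read off the suffix tree: the bit of `b_y` at
distance `d` after the occurrence is set for every leaf below `X`. -/
def NodeUnique (S : ColoredString α γ) (y : γ) (d : ℕ) (X : Node α) : Prop :=
  ∀ w, IsLeaf S w → X <+: w → bit S y (w.length - 1 + d) = true

/-- The nodes `u` that the algorithm extracts with key `d`: `u` is `(y,d)`-unique, and none of its
proper ancestors is. -/
structure LeftMinimal (S : ColoredString α γ) (y : γ) (d : ℕ) (u : Node α) : Prop where
  nodeUnique : NodeUnique S y d u
  not_nodeUnique : ∀ p, IsNode S p → p <+: u → p ≠ u → ¬ NodeUnique S y d p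

theorem bit_eq_true_iff {p : ℕ} : bit S y p = true ↔ S.colorAt p = some y ∨ S.len < p := by
  simp [bit]

theorem NodeUnique.of_prefix (h : NodeUnique S y d X) (hXY : X <+: Y) : NodeUnique S y d Y :=
  fun w hw hY => h w hw (hXY.trans hY)

theorem IsLocus.nodeUnique_iff (h : IsLocus S X u) : NodeUnique S y d u ↔ NodeUnique S y d X :=
  ⟨fun hu w hw hX => hu w hw (h.prefix_isLeaf hw hX), fun hX => hX.of_prefix h.isPrefix⟩

theorem nodeUnique_of_len_lt (h : S.len < d) (X : Node α) : NodeUnique S y d X :=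
  fun _ _ _ => bit_eq_true_iff.2 (Or.inr (h.trans_le le_add_self))

theorem LeftMinimal.le_len (h : LeftMinimal S y d u) (hu : u ≠ []) : d ≤ S.len :=
  not_lt.1 fun hd =>
    h.not_nodeUnique [] isNode_nil List.nil_prefix hu.symm (nodeUnique_of_len_lt hd _)

theorem NodeUnique.cons (a : α) (h : NodeUnique S y (d + 1) X) :
    NodeUnique S y d (some a :: X) := by
  rintro _ hw ⟨t, rfl⟩
  have hw' : IsLeaf S (X ++ t) := hw.of_cons
  have hbit := h _ hw' (List.prefix_append _ _)
  have hpos := hw'.length_pos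
  rwa [show (X ++ t).length - 1 + (d + 1) = (some a :: X ++ t).length - 1 + d by
    rw [List.cons_append, List.length_cons]; omega] at hbit

theorem NodeUnique.revLocus_append (B : List α) (h : NodeUnique S y (d + B.length) X) :
    NodeUnique S y d (revLocus B ++ X) := by
  induction B using List.reverseRecOn generalizing d with
  | nil => simpa [revLocus] using h
  | append_singleton B b ih =>
    rw [ColoredStrings.revLocus_append]
    refine NodeUnique.cons b (ih ?_)
    rwa [List.length_append, List.length_singleton, ← add_assoc, add_right_comm] at h

end NodeUnique

section IsUnique

variable {α γ : Type*} {S : ColoredString α γ} {y : γ} {d : ℕ} {T : List α}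

theorem revLocus_prefix_concat_none {T' : List α} :
    revLocus T <+: revLocus T' ++ [none] ↔ T <:+ T' := by
  rw [List.prefix_concat_iff, revLocus_prefix_iff]
  refine or_iff_right fun h => none_notMem_revLocus T ?_
  simp [h]

theorem revLocus_infix_text : revLocus T <:+: text S ↔ T <:+: S.str := by
  refine ⟨fun h => ?_, fun h => (revLocus_infix_iff.2 h).trans (List.infix_append' [] _ _)⟩
  obtain ⟨w, hw, hTw⟩ := exists_isLeaf_of_infix h
  obtain ⟨j, -, rfl⟩ := isLeaf_iff.1 hw
  exact (revLocus_prefix_concat_none.1 hTw).isInfix.trans (List.take_prefix _ _).isInfix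

theorem exists_revLocus_eq_cons (hT : T ≠ []) : ∃ b, revLocus T = some b :: (revLocus T).tail := by
  obtain ⟨B, b, rfl⟩ := (List.eq_nil_or_concat' T).resolve_left hT
  exact ⟨b, by simp [revLocus]⟩

theorem isOcc_iff_suffix_take {i : ℕ} :
    IsOcc S T i ↔ 1 ≤ i ∧ i + T.length ≤ S.len + 1 ∧ T <:+ S.str.take (i + T.length - 1) := by
  refine and_congr_right fun hi => and_congr_right fun hiT => ?_
  have hlen : i + T.length - 1 ≤ S.str.length := by unfold ColoredString.len at hiT; omega
  rw [List.suffix_iff_eq_drop, List.length_take, min_eq_left hlen, List.drop_take,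
    show i + T.length - 1 - T.length = i - 1 by omega,
    show i + T.length - 1 - (i - 1) = T.length by omega, eq_comm]

theorem isUnique_iff_forall_end [DecidableEq γ] :
    IsUnique S y d T ↔ T <:+: S.str ∧
      ∀ j ≤ S.len, T <:+ S.str.take j → bit S y (j + d) = true := by
  refine and_congr_right fun _ => ⟨fun h j hj hT => ?_, fun h i hi => ?_⟩
  · have hTj : T.length ≤ j := hT.length_le.trans (List.length_take_le _ _)
    have hend : j - T.length + 1 + T.length - 1 = j := by omega
    have hocc : IsOcc S T (j - T.length + 1) :=
      isOcc_iff_suffix_take.2 ⟨by omega, by omega, by rwa [hend]⟩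
    simpa only [IsGood, hend] using bit_eq_true_iff.2 (h _ hocc)
  · obtain ⟨hi, hiT, hT⟩ := isOcc_iff_suffix_take.1 hi
    exact bit_eq_true_iff.1 (h _ (by omega) hT)

theorem nodeUnique_revLocus_iff [DecidableEq γ] :
    NodeUnique S y d (revLocus T) ↔
      ∀ j ≤ S.len, T <:+ S.str.take j → bit S y (j + d) = true := by
  have hlen : ∀ j ≤ S.len, (revLocus (S.str.take j) ++ [none]).length - 1 = j := by
    intro j hj
    simpa [length_revLocus] using (show j ≤ S.str.length from hj)
  constructor
  · intro h j hj hT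
    have := h _ (isLeaf_iff.2 ⟨j, hj, rfl⟩) (revLocus_prefix_concat_none.2 hT)
    rwa [hlen j hj] at this
  · rintro h _ hw hT
    obtain ⟨j, hj, rfl⟩ := isLeaf_iff.1 hw
    rw [hlen j hj]
    exact h j hj (revLocus_prefix_concat_none.1 hT)

theorem isUnique_iff_nodeUnique [DecidableEq γ] :
    IsUnique S y d T ↔ T <:+: S.str ∧ NodeUnique S y d (revLocus T) := by
  rw [isUnique_iff_forall_end, nodeUnique_revLocus_iff]

theorem IsUnique.extend {A U B : List α} (hT : A ++ U ++ B <:+: S.str)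
    (h : IsUnique S y (d + B.length) U) : IsUnique S y d (A ++ U ++ B) := by
  classical
  refine isUnique_iff_nodeUnique.2 ⟨hT, ?_⟩
  rw [revLocus_append, revLocus_append, ← List.append_assoc]
  exact ((isUnique_iff_nodeUnique.1 h).2.revLocus_append B).of_prefix (List.prefix_append _ _)

theorem isMinUnique_iff (hT : T ≠ []) :
    IsMinUnique S y d T ↔ IsUnique S y d T ∧ ¬ IsUnique S y d T.tail ∧
      ¬ IsUnique S y (d + 1) T.dropLast := by
  have hpos := List.length_pos_iff.2 hT
  constructor
  · rintro ⟨h, hmin⟩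
    refine ⟨h, ?_, ?_⟩
    · refine hmin [T.head hT] T.tail [] (by simp) fun heq => ?_
      have := congrArg List.length heq
      rw [List.length_tail] at this
      omega
    · refine hmin [] T.dropLast [T.getLast hT] (by simp [List.dropLast_append_getLast]) ?_
      intro heq
      have := congrArg List.length heq
      rw [List.length_dropLast] at this
      omega
  · rintro ⟨h, htail, hdrop⟩
    refine ⟨h, ?_⟩
    rintro (_ | ⟨a, A⟩) U B rfl hU hUu
    · rcases List.eq_nil_or_concat' B with rfl | ⟨B, b, rfl⟩
      · simp at hU
      · rw [← List.append_assoc, List.dropLast_concat] at hdrop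
        refine hdrop (IsUnique.extend ?_ ?_)
        · exact (List.infix_append' [] _ [b]).trans (by simpa using h.1)
        · rwa [List.length_append, List.length_singleton, ← add_assoc, add_right_comm] at hUu
    · exact htail (IsUnique.extend ((List.suffix_cons a _).isInfix.trans h.1) hUu)

theorem isMinUnique_iff_nodeUnique [DecidableEq γ] (hT : T ≠ []) :
    IsMinUnique S y d T ↔ T <:+: S.str ∧ NodeUnique S y d (revLocus T) ∧
      ¬ NodeUnique S y d (revLocus T).dropLast ∧ ¬ NodeUnique S y (d + 1) (revLocus T).tail := by
  rw [isMinUnique_iff hT, dropLast_revLocus, tail_revLocus]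
  simp only [isUnique_iff_nodeUnique, and_assoc]
  refine and_congr_right fun hTS => and_congr_right fun _ => and_congr ?_ ?_
  · simp [(List.tail_suffix T).isInfix.trans hTS]
  · simp [(List.dropLast_prefix T).isInfix.trans hTS]

end IsUnique

section LeftMinimal

variable {α γ : Type*} {S : ColoredString α γ} {y : γ} {d : ℕ} {X p u v : Node α}

theorem take_succ_length_eq_append (h : v <+: u) (hne : v ≠ u) :
    ∃ a, u.take (v.length + 1) = v ++ [a] := by
  obtain ⟨_ | ⟨a, t⟩, rfl⟩ := h
  · simp at hne
  · exact ⟨a, by simp [List.take_append]⟩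

theorem IsLocus.prefix_dropLast (h : IsLocus S X u) (hp : IsNode S p) (hpu : p <+: u)
    (hne : p ≠ u) : p <+: X.dropLast := by
  have := h.length_lt p hp hpu hne
  refine List.prefix_of_prefix_length_le hpu ((List.dropLast_prefix X).trans h.isPrefix) ?_
  rw [List.length_dropLast]
  omega

variable [DecidableEq γ]

theorem IsLocus.leftMinimal (h : IsLocus S X u) (hX : NodeUnique S y d X)
    (hX' : ¬ NodeUnique S y d X.dropLast) : LeftMinimal S y d u :=
  ⟨h.nodeUnique_iff.2 hX, fun _ hp hpu hne hpd =>
    hX' (hpd.of_prefix (h.prefix_dropLast hp hpu hne))⟩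

theorem IsLocus.isNode_dropLast (h : IsLocus S X u) (hX : NodeUnique S y d X)
    (hX' : ¬ NodeUnique S y d X.dropLast) : IsNode S X.dropLast := by
  by_contra hn
  have hloc : IsLocus S X.dropLast u := by
    refine ⟨h.isNode, (List.dropLast_prefix X).trans h.isPrefix, fun p hp hpu hne => ?_⟩
    have hpX := h.prefix_dropLast hp hpu hne
    exact length_lt_of_prefix_of_ne hpX fun heq => hn (heq ▸ hp)
  exact hX' (hloc.nodeUnique_iff.1 (h.nodeUnique_iff.2 hX))

theorem IsLocus.leftMinimal_succ_iff {b : α} (h : IsLocus S X u)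
    (hX : ¬ NodeUnique S y d (some b :: X).dropLast) :
    LeftMinimal S y (d + 1) u ↔ NodeUnique S y (d + 1) X := by
  refine ⟨fun hu => h.nodeUnique_iff.1 hu.nodeUnique, fun hu =>
    ⟨h.nodeUnique_iff.2 hu, fun p hp hpu hne hpd => hX ?_⟩⟩
  have hX0 : X ≠ [] := List.length_pos_iff.1 (Nat.zero_lt_of_lt (h.length_lt p hp hpu hne))
  rw [List.dropLast_cons_of_ne_nil hX0]
  exact (hpd.of_prefix (h.prefix_dropLast hp hpu hne)).cons b

end LeftMinimal

section LeftMin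

variable {α γ : Type*} [DecidableEq α] {S : ColoredString α γ} {y : γ} {d : ℕ}
  {ord : List (Node α)} {T : List α} {X u v : Node α}

theorem leftMin_eq_some (hu : IsNode S u) (hv : parent S u = some v) :
    leftMin S u = some T ↔ u.take (v.length + 1) = revLocus T := by
  obtain ⟨⟨-, hvu, hne⟩, -⟩ := parent_eq_some.1 hv
  obtain ⟨a, ha⟩ := take_succ_length_eq_append hvu hne
  have hau : v ++ [a] <+: u := ha ▸ List.take_prefix _ _
  obtain ⟨V, rfl⟩ : ∃ V, v = revLocus V := exists_eq_revLocus <| dropLast_text S ▸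
    infix_dropLast_of_append_infix (hau.isInfix.trans hu.infix_text) (List.cons_ne_nil a [])
  simp only [leftMin, hv, ha]
  cases a with
  | none =>
    have hu_eq : u = revLocus V ++ [none] := by
      obtain ⟨t, rfl⟩ := hau
      by_contra ht
      have hinfix := infix_dropLast_of_append_infix hu.infix_text (t := t) (by simpa using ht)
      rw [dropLast_text] at hinfix
      exact none_notMem_revLocus _ (hinfix.subset (by simp))
    rw [if_pos hu_eq]
    simp only [reduceCtorEq, false_iff]
    exact fun h => none_notMem_revLocus T (h ▸ by simp)
  | some a =>
    have hu_ne : u ≠ revLocus V ++ [none] := by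
      rintro rfl
      simp [List.take_of_length_le] at ha
    have hcons : revLocus V ++ [some a] = revLocus (a :: V) := by simp [revLocus]
    rw [if_neg hu_ne, hcons, revLocus_injective.eq_iff, Option.some.injEq]
    simp [revLocus, List.reduceOption]

theorem IsLocus.parent_eq (h : IsLocus S X u) (hX : X ≠ []) (hX' : IsNode S X.dropLast) :
    parent S u = some X.dropLast := by
  refine parent_eq_some.2 ⟨⟨hX', (List.dropLast_prefix X).trans h.isPrefix, ?_⟩,
    fun p hp hpu hne => h.prefix_dropLast hp hpu hne⟩
  rintro rfl
  have := h.isPrefix.length_le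
  rw [List.length_dropLast] at this
  have := List.length_pos_iff.2 hX
  omega

theorem isLocus_of_parent_eq (hu : IsNode S u) (hv : parent S u = some v)
    (hX : u.take (v.length + 1) = X) : IsLocus S X u ∧ X ≠ [] ∧ X.dropLast = v := by
  obtain ⟨⟨-, hvu, hne⟩, hmax⟩ := parent_eq_some.1 hv
  obtain ⟨a, ha⟩ := take_succ_length_eq_append hvu hne
  obtain rfl : v ++ [a] = X := ha.symm.trans hX
  refine ⟨⟨hu, ha ▸ List.take_prefix _ _, fun p hp hpu hpne => ?_⟩, by simp, by simp⟩
  have := (hmax p hp hpu hpne).length_le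
  rw [List.length_append, List.length_singleton]
  omega

variable [DecidableEq γ]

theorem isMinUnique_of_leftMinimal (ho : IsLevelOrder S ord) (hu : IsNode S u)
    (hv : parent S u = some v) (hT : leftMin S u = some T) (hmin : LeftMinimal S y d u)
    (hlink : ¬ LeftMinimal S y (d + 1) (slinkNode S ord u v)) :
    T ≠ [] ∧ d ≤ S.len ∧ IsMinUnique S y d T := by
  have hX := (leftMin_eq_some hu hv).1 hT
  obtain ⟨hloc, hT0, rfl⟩ := isLocus_of_parent_eq hu hv hX
  obtain ⟨⟨hvn, hvu, hne⟩, -⟩ := parent_eq_some.1 hv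
  have hv' := hmin.not_nodeUnique _ hvn hvu hne
  have hTS := hloc.isPrefix.isInfix.trans hu.infix_text
  refine ⟨revLocus_ne_nil.1 hT0, hmin.le_len (ne_nil_of_parent_eq_some hv),
    (isMinUnique_iff_nodeUnique (revLocus_ne_nil.1 hT0)).2 ⟨revLocus_infix_text.1 hTS,
      hloc.nodeUnique_iff.1 hmin.nodeUnique, hv', fun hd => hlink ?_⟩⟩
  obtain ⟨b, hb⟩ := exists_revLocus_eq_cons (revLocus_ne_nil.1 hT0)
  have hlink' := isLocus_locusNode ho ((List.tail_suffix _).isInfix.trans hTS)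
  rw [slinkNode, hX]
  exact (hlink'.leftMinimal_succ_iff (hb ▸ hv')).2 hd

theorem exists_leftMinimal_of_isMinUnique (ho : IsLevelOrder S ord) (hT : T ≠ [])
    (h : IsMinUnique S y d T) :
    ∃ u v, IsNode S u ∧ parent S u = some v ∧ leftMin S u = some T ∧ LeftMinimal S y d u ∧
      ¬ LeftMinimal S y (d + 1) (slinkNode S ord u v) := by
  obtain ⟨hTS, hd, hleft, hright⟩ := (isMinUnique_iff_nodeUnique hT).1 h
  have hTS' := revLocus_infix_text.2 hTS
  obtain ⟨u, hu⟩ := exists_isLocus hTS'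
  have hv := hu.parent_eq (revLocus_ne_nil.2 hT) (hu.isNode_dropLast hd hleft)
  have hX : u.take ((revLocus T).dropLast.length + 1) = revLocus T := by
    rw [List.length_dropLast, Nat.sub_add_cancel (List.length_pos_iff.2 (revLocus_ne_nil.2 hT))]
    exact (List.prefix_iff_eq_take.1 hu.isPrefix).symm
  refine ⟨u, _, hu.isNode, hv, (leftMin_eq_some hu.isNode hv).2 hX, hu.leftMinimal hd hleft, ?_⟩
  obtain ⟨b, hb⟩ := exists_revLocus_eq_cons hT
  have hlink := isLocus_locusNode ho ((List.tail_suffix _).isInfix.trans hTS')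
  rw [slinkNode, hX]
  exact fun h => hright ((hlink.leftMinimal_succ_iff (hb ▸ hleft)).1 h)

end LeftMin

/-! ### Keys and extractions -/

section DemotedKey

theorem le_csSup_iff_mem_of_isLowerSet {A : Set ℤ} (hA : IsLowerSet A) (hne : A.Nonempty)
    (hbdd : BddAbove A) {x : ℤ} : x ≤ sSup A ↔ x ∈ A :=
  ⟨fun hx => hA hx (Int.csSup_mem hne hbdd), fun hx => le_csSup hbdd hx⟩

variable {α γ : Type*} [DecidableEq γ] {S : ColoredString α γ} {y : γ} {ℓ d : ℕ} {u v w : Node α}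

/-- The value of `h(u,ℓ)`: the minimum, over the leaves `w` below `u`, of the largest delay
`d < ℓ` for which `w` is unique, or of `-1` if there is none. It is encoded as the largest `x < ℓ`
which is at most each of these. -/
noncomputable def demotedKey (S : ColoredString α γ) (y : γ) (ℓ : ℕ) (u : Node α) : ℤ :=
  sSup {x | x < ℓ ∧ ∀ w, IsLeaf S w → u <+: w → 0 ≤ x →
    ∃ d < ℓ, x ≤ d ∧ bit S y (w.length - 1 + d) = true}

theorem le_demotedKey_iff {x : ℤ} :
    x ≤ demotedKey S y ℓ u ↔ x < ℓ ∧ ∀ w, IsLeaf S w → u <+: w → 0 ≤ x →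
      ∃ d < ℓ, x ≤ d ∧ bit S y (w.length - 1 + d) = true := by
  refine le_csSup_iff_mem_of_isLowerSet ?_ ?_ ⟨ℓ, fun x hx => hx.1.le⟩
  · rintro a b hba ⟨ha, ha'⟩
    refine ⟨hba.trans_lt ha, fun w hw huw hb => ?_⟩
    obtain ⟨d, hd, had, hbit⟩ := ha' w hw huw (hb.trans hba)
    exact ⟨d, hd, hba.trans had, hbit⟩
  · exact ⟨-1, neg_one_lt_zero.trans_le (Int.natCast_nonneg ℓ), fun _ _ _ h => absurd h (by decide)⟩

theorem neg_one_le_demotedKey : -1 ≤ demotedKey S y ℓ u :=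
  le_demotedKey_iff.2 ⟨neg_one_lt_zero.trans_le (Int.natCast_nonneg ℓ),
    fun _ _ _ h => absurd h (by decide)⟩

theorem demotedKey_lt : demotedKey S y ℓ u < ℓ := (le_demotedKey_iff.1 le_rfl).1

theorem demotedKey_mono (h : u <+: w) : demotedKey S y ℓ u ≤ demotedKey S y ℓ w :=
  le_demotedKey_iff.2 ⟨demotedKey_lt, fun l hl hwl =>
    (le_demotedKey_iff.1 le_rfl).2 l hl (h.trans hwl)⟩

theorem NodeUnique.le_demotedKey (h : NodeUnique S y d u) (hd : d < ℓ) :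
    (d : ℤ) ≤ demotedKey S y ℓ u :=
  le_demotedKey_iff.2 ⟨Int.ofNat_lt.2 hd, fun w hw huw _ => ⟨d, hd, le_rfl, h w hw huw⟩⟩

/-- The positions before `q` of the ones of the bitvector, and `-1`, which is `select(0)`. -/
def onesBefore (S : ColoredString α γ) (y : γ) (q : ℕ) : Set ℤ :=
  insert (-1) {x | ∃ p < q, bit S y p = true ∧ (p : ℤ) = x}

theorem demotedKey_eq_of_isLeaf (hw : IsLeaf S w) {g : ℤ}
    (hg : IsGreatest (onesBefore S y (w.length - 1 + ℓ)) g) :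
    demotedKey S y ℓ w = max (g - (w.length - 1 : ℕ)) (-1) := by
  set j := w.length - 1
  have hg_lt : g < j + ℓ := by
    rcases hg.1 with rfl | ⟨p, hp, -, rfl⟩ <;> omega
  have hleaf : ∀ v, IsLeaf S v → w <+: v → v = w := fun v hv => hw.eq_of_prefix hv.2.isInfix
  refine eq_of_forall_le_iff fun x => le_demotedKey_iff.trans ⟨?_, ?_⟩
  · rintro ⟨-, hx⟩
    rcases lt_or_ge x 0 with hx0 | hx0
    · exact le_max_of_le_right (by omega)
    · obtain ⟨d, hd, hxd, hbit⟩ := hx w hw List.prefix_rfl hx0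
      have := hg.2 (Or.inr ⟨j + d, by omega, hbit, rfl⟩)
      exact le_max_of_le_left (by push_cast at this; omega)
  · intro hx
    refine ⟨by omega, fun v hv hwv hx0 => ?_⟩
    rw [hleaf v hv hwv]
    rcases hg.1 with rfl | ⟨p, hp, hbit, rfl⟩
    · omega
    · exact ⟨p - j, by omega, by omega, by rwa [show j + (p - j) = p by omega]⟩

theorem le_demotedKey_iff_children [DecidableEq α] {ord : List (Node α)} (ho : IsLevelOrder S ord)
    (hu : IsNode S u) (hleaf : ¬ IsLeaf S u) {x : ℤ} :
    x ≤ demotedKey S y ℓ u ↔ x < ℓ ∧ ∀ v ∈ children S ord u, x ≤ demotedKey S y ℓ v := by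
  constructor
  · exact fun hx => ⟨hx.trans_lt demotedKey_lt, fun v hv =>
      hx.trans (demotedKey_mono (prefix_of_mem_children ho hv))⟩
  · rintro ⟨hxℓ, hx⟩
    refine le_demotedKey_iff.2 ⟨hxℓ, fun w hw huw => ?_⟩
    obtain ⟨v, hv, hvw⟩ := exists_mem_children_prefix ho hu hw.isNode huw fun h => hleaf (h ▸ hw)
    exact (le_demotedKey_iff.1 (hx v hv)).2 w hw hvw

theorem nodeUnique_of_isLeaf (hw : IsLeaf S w) (h : bit S y (w.length - 1 + d) = true) :
    NodeUnique S y d w := fun v hv hwv => by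
  rwa [hw.eq_of_prefix hv.2.isInfix hwv]

theorem demotedKey_eq_neg_one_or_nodeUnique (hw : IsLeaf S w) :
    demotedKey S y ℓ w = -1 ∨ ∃ d : ℕ, demotedKey S y ℓ w = d ∧ NodeUnique S y d w := by
  rcases lt_or_ge (demotedKey S y ℓ w) 0 with h | h
  · have := neg_one_le_demotedKey (S := S) (y := y) (ℓ := ℓ) (u := w)
    exact Or.inl (by omega)
  · obtain ⟨d, hd, hle, hbit⟩ := (le_demotedKey_iff.1 le_rfl).2 w hw List.prefix_rfl h
    have hd' := nodeUnique_of_isLeaf hw hbit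
    exact Or.inr ⟨d, hle.antisymm (hd'.le_demotedKey hd), hd'⟩

end DemotedKey

section Skip

variable {α γ : Type*} [DecidableEq γ] {S : ColoredString α γ} {y : γ} {d e : ℕ}
  {u v w : Node α} {K K' : Node α → ℤ}

/-- What the main loop preserves about the keys `K` of the nodes. By `nodeUnique_leaf`, the key of
a leaf is a delay for which the leaf is unique; by `closed`, no delay for which an inner node is
unique is jumped over by some of its descendants only. -/
structure KeyInv (S : ColoredString α γ) (y : γ) (K : Node α → ℤ) : Prop where
  neg_one_le : ∀ w, IsNode S w → -1 ≤ K w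
  mono : ∀ v w, IsNode S v → IsNode S w → v <+: w → K v ≤ K w
  nodeUnique_leaf : ∀ w, IsLeaf S w → K w = -1 ∨ ∃ d : ℕ, K w = d ∧ NodeUnique S y d w
  closed : ∀ v w, IsNode S v → IsNode S w → v <+: w → ∀ d : ℕ, NodeUnique S y d v →
    (d : ℤ) ≤ K w → (d : ℤ) ≤ K v

theorem keyInv_of_forall_eq (hd : S.len < d) (hK : ∀ w, IsNode S w → K w = d) :
    KeyInv S y K where
  neg_one_le w hw := (hK w hw).symm ▸ (neg_one_lt_zero.le.trans (Int.natCast_nonneg d))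
  mono v w hv hw _ := ((hK v hv).trans (hK w hw).symm).le
  nodeUnique_leaf w hw := Or.inr ⟨d, hK w hw.isNode, nodeUnique_of_len_lt hd w⟩
  closed v w hv hw _ _ _ he := he.trans_eq ((hK w hw).trans (hK v hv).symm)

/-- `u` is a node that the queue may return, with key `d`: it has the largest key, and since ties
are broken in favor of the larger index, its proper ancestors have smaller keys. -/
structure HasTopKey (S : ColoredString α γ) (K : Node α → ℤ) (u : Node α) (d : ℕ) : Prop where
  isNode : IsNode S u
  key_eq : K u = d
  key_le : ∀ w, IsNode S w → K w ≤ d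
  key_lt : ∀ w, IsNode S w → w <+: u → w ≠ u → K w < d

theorem KeyInv.key_eq_of_prefix (h : KeyInv S y K) (hu : HasTopKey S K u d) (hw : IsNode S w)
    (huw : u <+: w) : K w = d :=
  (hu.key_le w hw).antisymm (hu.key_eq.symm.trans_le (h.mono u w hu.isNode hw huw))

theorem KeyInv.leftMinimal (h : KeyInv S y K) (hu : HasTopKey S K u d) : LeftMinimal S y d u where
  nodeUnique w hw huw := by
    have hKw := h.key_eq_of_prefix hu hw.isNode huw
    rcases h.nodeUnique_leaf w hw with hKw' | ⟨p, hp, hpw⟩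
    · omega
    · obtain rfl : p = d := by omega
      exact hpw w hw List.prefix_rfl
  not_nodeUnique p hp hpu hne hpd :=
    (h.closed p u hp hu.isNode hpu d hpd hu.key_eq.ge).not_gt (hu.key_lt p hp hpu hne)

/-- The left-minimal pair `(u,d)` has already been extracted when the keys are `K`. -/
structure Extracted (S : ColoredString α γ) (y : γ) (K : Node α → ℤ) (u : Node α) (d : ℕ) :
    Prop where
  le_len_succ : d ≤ S.len + 1
  leftMinimal : LeftMinimal S y d u
  key_lt : K u < d

variable [DecidableEq α]

/-- The keys after an iteration that extracts `u` with key `d`, where `K` are the keys before. -/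
noncomputable def skipKey (S : ColoredString α γ) (y : γ) (K : Node α → ℤ) (u : Node α) (d : ℕ)
    (w : Node α) : ℤ :=
  if u <+: w then demotedKey S y d w else if w <+: u then min (K w) (demotedKey S y d u) else K w

theorem KeyInv.skipKey_le (h : KeyInv S y K) (hu : HasTopKey S K u d) (hw : IsNode S w) :
    skipKey S y K u d w ≤ K w := by
  unfold skipKey
  split_ifs with huw
  · exact demotedKey_lt.le.trans_eq (h.key_eq_of_prefix hu hw huw).symm
  · exact min_le_left _ _
  · exact le_rfl

theorem HasTopKey.le_skipKey (hu : HasTopKey S K u d) (hw : IsNode S w)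
    (he : NodeUnique S y e w) (hew : (e : ℤ) ≤ K w) :
    (e : ℤ) ≤ skipKey S y K u d w ∨ u <+: w ∧ e = d := by
  unfold skipKey
  split_ifs with huw hwu
  · have := hu.key_le w hw
    rcases eq_or_ne e d with hed | hed
    · exact Or.inr ⟨huw, hed⟩
    · exact Or.inl (he.le_demotedKey (by omega))
  · have := hu.key_lt w hw hwu fun heq => huw (heq ▸ List.prefix_rfl)
    exact Or.inl (le_min hew ((he.of_prefix hwu).le_demotedKey (by omega)))
  · exact Or.inl hew

theorem KeyInv.skipKey_mono (h : KeyInv S y K) (hv : IsNode S v) (hw : IsNode S w)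
    (hvw : v <+: w) : skipKey S y K u d v ≤ skipKey S y K u d w := by
  have hKvw := h.mono v w hv hw hvw
  unfold skipKey
  split_ifs with huv huw hwu hvu huw hwu huw hwu
  · exact demotedKey_mono hvw
  · exact absurd (huv.trans hvw) huw
  · exact absurd (huv.trans hvw) huw
  · exact min_le_of_right_le (demotedKey_mono huw)
  · exact min_le_min_right _ hKvw
  · exact min_le_of_left_le hKvw
  · exact ((List.prefix_or_prefix_of_prefix hvw huw).elim hvu huv).elim
  · exact absurd (hvw.trans hwu) hvu
  · exact hKvw

theorem KeyInv.skip (h : KeyInv S y K) (hu : HasTopKey S K u d)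
    (hK' : ∀ w, IsNode S w → K' w = skipKey S y K u d w) : KeyInv S y K' where
  neg_one_le w hw := by
    rw [hK' w hw, skipKey]
    split_ifs
    · exact neg_one_le_demotedKey
    · exact le_min (h.neg_one_le w hw) neg_one_le_demotedKey
    · exact h.neg_one_le w hw
  mono v w hv hw hvw := by
    rw [hK' v hv, hK' w hw]
    exact h.skipKey_mono hv hw hvw
  nodeUnique_leaf w hw := by
    rw [hK' w hw.isNode, skipKey]
    split_ifs with huw hwu
    · exact demotedKey_eq_neg_one_or_nodeUnique hw
    · exact absurd (hw.eq_of_prefix hu.isNode.infix_text hwu ▸ List.prefix_rfl) huw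
    · exact h.nodeUnique_leaf w hw
  closed v w hv hw hvw e he hew := by
    rw [hK' v hv]
    rw [hK' w hw] at hew
    refine (hu.le_skipKey hv he (h.closed v w hv hw hvw e he
      (hew.trans (h.skipKey_le hu hw)))).resolve_right ?_
    rintro ⟨huv, rfl⟩
    rw [skipKey, if_pos (huv.trans hvw)] at hew
    exact hew.not_gt demotedKey_lt

theorem KeyInv.extracted_skip_iff (h : KeyInv S y K) (hu : HasTopKey S K u d)
    (hd : d ≤ S.len + 1) (hK' : ∀ w, IsNode S w → K' w = skipKey S y K u d w) (hw : IsNode S w) :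
    Extracted S y K' w e ↔ Extracted S y K w e ∨ w = u ∧ e = d := by
  have hKw := h.skipKey_le hu hw
  rw [← hK' w hw] at hKw
  constructor
  · rintro ⟨hen, hmin, hlt⟩
    rcases lt_or_ge (K w) e with hlt' | hge
    · exact Or.inl ⟨hen, hmin, hlt'⟩
    · obtain ⟨huw, rfl⟩ := (hu.le_skipKey hw hmin.nodeUnique hge).resolve_left
        (by rw [← hK' w hw]; exact hlt.not_ge)
      refine Or.inr ⟨?_, rfl⟩
      by_contra hne
      exact hmin.not_nodeUnique u hu.isNode huw (Ne.symm hne) (h.leftMinimal hu).nodeUnique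
  · rintro (hE | ⟨rfl, rfl⟩)
    · exact ⟨hE.le_len_succ, hE.leftMinimal, hKw.trans_lt hE.key_lt⟩
    · refine ⟨hd, h.leftMinimal hu, ?_⟩
      rw [hK' w hw, skipKey, if_pos List.prefix_rfl]
      exact demotedKey_lt

end Skip

section Records

variable {α γ : Type*} [DecidableEq γ] {S : ColoredString α γ} {y : γ} {d e : ℕ}
  {u v w : Node α} {K K' : Node α → ℤ} {R R' : ℕ → Node α → Option ℕ}

/-- What the main loop preserves about the record `R` of extractions: for each parity and each
node, it holds the last extraction of the node with a delay of this parity. -/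
structure RecordInv (S : ColoredString α γ) (y : γ) (K : Node α → ℤ)
    (R : ℕ → Node α → Option ℕ) : Prop where
  mod_two : ∀ u, IsNode S u → ∀ p e, R p u = some e → e % 2 = p
  leftMinimal : ∀ u, IsNode S u → ∀ p e, R p u = some e → LeftMinimal S y e u
  key_le : ∀ u, IsNode S u → ∀ p e, R p u = some e → ∀ w, IsNode S w → K w ≤ e
  exists_of_extracted : ∀ u, IsNode S u → ∀ e, Extracted S y K u e →
    ∃ e' ≤ e, R (e % 2) u = some e'

theorem recordInv_of_forall_eq_none (hE : ∀ u e, IsNode S u → ¬Extracted S y K u e)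
    (hR : ∀ p u, R p u = none) : RecordInv S y K R where
  mod_two u _ p _ he := absurd he (hR p u ▸ nofun)
  leftMinimal u _ p _ he := absurd he (hR p u ▸ nofun)
  key_le u _ p _ he := absurd he (hR p u ▸ nofun)
  exists_of_extracted u hu e he := absurd he (hE u e hu)

/-- Looking only at the parity of the delay suffices: an entry for the parity of `d + 1` which is
at least the current maximum `d` and at most `d + 1` equals `d + 1`. -/
theorem RecordInv.eq_some_succ_iff (hR : RecordInv S y K R) (hu : HasTopKey S K u d)
    (hd : d ≤ S.len) (hw : IsNode S w) :
    R ((d + 1) % 2) w = some (d + 1) ↔ LeftMinimal S y (d + 1) w := by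
  refine ⟨hR.leftMinimal w hw _ _, fun hmin => ?_⟩
  have hKw : K w < (d + 1 : ℕ) := (hu.key_le w hw).trans_lt (by omega)
  obtain ⟨e, he, hRe⟩ := hR.exists_of_extracted w hw _ ⟨by omega, hmin, hKw⟩
  have hmod := hR.mod_two w hw _ _ hRe
  have hge := hu.key_eq ▸ hR.key_le w hw _ _ hRe u hu.isNode
  rwa [show e = d + 1 by omega] at hRe

variable [DecidableEq α]

theorem RecordInv.skip (hR : RecordInv S y K R) (hK : KeyInv S y K) (hu : HasTopKey S K u d)
    (hd : d ≤ S.len + 1) (hK' : ∀ w, IsNode S w → K' w = skipKey S y K u d w)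
    (hR' : ∀ p w, IsNode S w → R' p w = if p = d % 2 ∧ w = u then some d else R p w) :
    RecordInv S y K' R' where
  mod_two w hw p e he := by
    rw [hR' p w hw] at he
    split_ifs at he with hpw
    · exact Option.some.inj he ▸ hpw.1.symm
    · exact hR.mod_two w hw p e he
  leftMinimal w hw p e he := by
    rw [hR' p w hw] at he
    split_ifs at he with hpw
    · rw [← Option.some.inj he, hpw.2]
      exact hK.leftMinimal hu
    · exact hR.leftMinimal w hw p e he
  key_le w hw p e he v hv := by
    refine (hK' v hv).trans_le ((hK.skipKey_le hu hv).trans ?_)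
    rw [hR' p w hw] at he
    split_ifs at he with hpw
    · exact Option.some.inj he ▸ hu.key_le v hv
    · exact hR.key_le w hw p e he v hv
  exists_of_extracted w hw e he := by
    rw [hR' _ w hw]
    split_ifs with hpw
    · refine ⟨d, ?_, rfl⟩
      rcases (hK.extracted_skip_iff hu hd hK' hw).1 he with hE | ⟨-, rfl⟩
      · have := hE.key_lt
        rw [hpw.2, hu.key_eq] at this
        omega
      · exact le_rfl
    · rcases (hK.extracted_skip_iff hu hd hK' hw).1 he with hE | ⟨rfl, rfl⟩
      · exact hR.exists_of_extracted w hw e hE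
      · exact absurd ⟨rfl, rfl⟩ hpw

end Records

/-! ### The tournament tree -/

section Queue

variable {α : Type*} {key : ℕ → ℤ} {I A B : Set ℕ} {L l x z i j : ℕ} {o p : Option ℕ} {k : ℤ}
  {win : ℕ → Option ℕ} {s : Store α}

/-- The indices whose leaf `2 ^ L + i` lies at or below the entry `x` of the tournament tree with
`2 ^ L` leaves. -/
def subtree (L x : ℕ) : Set ℕ := {i | i < 2 ^ L ∧ ∃ t, (2 ^ L + i) / 2 ^ t = x}

theorem subtree_eq_union (hx : x < 2 ^ L) :
    subtree L x = subtree L (2 * x) ∪ subtree L (2 * x + 1) := by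
  ext i
  constructor
  · rintro ⟨hi, t, ht⟩
    cases t with
    | zero => rw [pow_zero, Nat.div_one] at ht; omega
    | succ t =>
      rw [pow_succ, ← Nat.div_div_eq_div_mul] at ht
      rcases Nat.mod_two_eq_zero_or_one ((2 ^ L + i) / 2 ^ t) with h | h
      · exact Or.inl ⟨hi, t, by omega⟩
      · exact Or.inr ⟨hi, t, by omega⟩
  · rintro (⟨hi, t, ht⟩ | ⟨hi, t, ht⟩) <;>
    exact ⟨hi, t + 1, by rw [pow_succ, ← Nat.div_div_eq_div_mul, ht]; omega⟩

theorem mem_subtree_one (hi : i < 2 ^ L) : i ∈ subtree L 1 :=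
  ⟨hi, L, by rw [Nat.add_div_left _ (by positivity), Nat.div_eq_of_lt hi]⟩

theorem eq_of_mem_subtree_leaf (h : j ∈ subtree L (2 ^ L + i)) : j = i := by
  obtain ⟨hj, t, ht⟩ := h
  cases t with
  | zero => rw [pow_zero, Nat.div_one] at ht; omega
  | succ t =>
    rw [pow_succ, mul_comm, ← Nat.div_div_eq_div_mul] at ht
    have := Nat.div_le_self ((2 ^ L + j) / 2) (2 ^ t)
    omega

theorem notMem_subtree (hz : z ≠ 2 ^ L + i) (h : ∀ t, z ≠ (2 ^ L + i) / 2 / 2 ^ t) :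
    i ∉ subtree L z := by
  rintro ⟨-, t, ht⟩
  cases t with
  | zero => exact hz (by rw [← ht, pow_zero, Nat.div_one])
  | succ t => exact h t (by rw [← ht, pow_succ, mul_comm, Nat.div_div_eq_div_mul])

/-- `o` is the index of the largest key in `A`, the largest such index in case of ties, and `none`
if `A` is empty. -/
def IsBest (key : ℕ → ℤ) (A : Set ℕ) (o : Option ℕ) : Prop :=
  match o with
  | none => A = ∅
  | some j => j ∈ A ∧ ∀ i ∈ A, key i < key j ∨ key i = key j ∧ i ≤ j

theorem IsBest.better (hA : IsBest key A o) (hB : IsBest key B p) :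
    IsBest key (A ∪ B) (better key o p) := by
  rcases o with - | i <;> rcases p with - | j <;> simp only [ColoredStrings.better]
  · exact Set.union_empty_iff.2 ⟨hA, hB⟩
  · rwa [show A = ∅ from hA, Set.empty_union]
  · rwa [show B = ∅ from hB, Set.union_empty]
  · obtain ⟨hi, hA⟩ := hA
    obtain ⟨hj, hB⟩ := hB
    split_ifs with hij
    · refine ⟨Or.inr hj, fun a ha => ha.elim (fun ha => ?_) (hB a)⟩
      have := hA a ha
      omega
    · refine ⟨Or.inl hi, fun a ha => ha.elim (hA a) fun ha => ?_⟩
      have := hB a ha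
      omega

theorem IsBest.congr {key' : ℕ → ℤ} (h : IsBest key A o) (hkey : ∀ i ∈ A, key' i = key i) :
    IsBest key' A o := by
  cases o with
  | none => exact h
  | some j => exact ⟨h.1, fun i hi => by rw [hkey i hi, hkey j h.1]; exact h.2 i hi⟩

/-- Each of the entries `1, …, 2 ^ (L + 1) - 1` of the tournament tree holds the winner among the
indices of `I` below it. -/
def IsHeap (L : ℕ) (I : Set ℕ) (key : ℕ → ℤ) (win : ℕ → Option ℕ) : Prop :=
  ∀ z, 1 ≤ z → z < 2 ^ (L + 1) → IsBest key (I ∩ subtree L z) (win z)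

theorem climb_eq (l x : ℕ) (s : Store α) :
    s.climb l x = { s with win := (s.climb l x).win, time := s.time + l } := by
  induction l generalizing x s with
  | zero => rfl
  | succ l ih =>
    refine (ih _ _).trans ?_
    simp only [Store.climb, Store.tick]
    congr 1
    omega

theorem setKey_eq (L i : ℕ) (k : ℤ) (s : Store α) :
    s.setKey L i k = { s with
      key := Function.update s.key i k
      win := (s.setKey L i k).win
      time := s.time + (L + 1) } := by
  refine (climb_eq _ _ _).trans ?_
  simp only [Store.setKey, Store.tick]
  congr 1
  omega

theorem demote_eq (L i : ℕ) (k : ℤ) (s : Store α) :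
    s.demote L i k = { s with
      key := Function.update s.key i k
      win := (s.setKey L i k).win
      demotes := Function.update s.demotes i (s.demotes i + 1)
      time := s.time + (L + 1) } := by
  rw [Store.demote, setKey_eq]

theorem isHeap_climb (hl : l ≤ L) (hx : x < 2 ^ l)
    (h : ∀ z, 1 ≤ z → z < 2 ^ (L + 1) → (∀ t, z ≠ x / 2 ^ t) →
      IsBest s.key (I ∩ subtree L z) (s.win z)) :
    IsHeap L I s.key (s.climb l x).win := by
  induction l generalizing x s with
  | zero =>
    intro z hz hzL
    refine h z hz hzL fun t => ?_
    rw [Nat.lt_one_iff.1 hx, Nat.zero_div]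
    omega
  | succ l ih =>
    have hxL : x < 2 ^ L := hx.trans_le (Nat.pow_le_pow_right two_pos hl)
    rw [pow_succ] at hx
    refine ih (s := { s.tick with
      win := Function.update s.win x (better s.key (s.win (2 * x)) (s.win (2 * x + 1))) })
      (by omega) (by omega) fun z hz hzL hzx => ?_
    rcases eq_or_ne z x with rfl | hne
    · have hle : ∀ t, z / 2 ^ t ≤ z := fun t => Nat.div_le_self _ _
      rw [pow_succ] at hzL
      simp only [Store.tick, Function.update_self]
      rw [subtree_eq_union hxL, Set.inter_union_distrib_left]
      exact (h (2 * z) (by omega) (by rw [pow_succ]; omega) fun t => by have := hle t; omega).better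
        (h (2 * z + 1) (by omega) (by rw [pow_succ]; omega) fun t => by have := hle t; omega)
    · simp only [Store.tick, Function.update_of_ne hne]
      refine h z hz hzL fun t => ?_
      cases t with
      | zero => rwa [pow_zero, Nat.div_one]
      | succ t =>
        rw [pow_succ, mul_comm, ← Nat.div_div_eq_div_mul]
        exact hzx t

theorem IsHeap.setKey (h : IsHeap L I s.key s.win) (hi : i < 2 ^ L) :
    IsHeap L (insert i I) (s.setKey L i k).key (s.setKey L i k).win := by
  rw [setKey_eq]
  refine isHeap_climb (s := { s.tick with
    key := Function.update s.key i k
    win := Function.update s.win (2 ^ L + i) (some i) }) le_rfl (by omega) fun z hz hzL hzi => ?_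
  simp only
  rcases eq_or_ne z (2 ^ L + i) with rfl | hne
  · rw [Function.update_self]
    refine ⟨⟨Set.mem_insert i I, hi, 0, by rw [pow_zero, Nat.div_one]⟩, fun j hj => ?_⟩
    rw [eq_of_mem_subtree_leaf hj.2]
    exact Or.inr ⟨rfl, le_rfl⟩
  · have hi' := notMem_subtree hne hzi
    rw [Function.update_of_ne hne, Set.insert_inter_of_notMem hi']
    exact (h z hz hzL).congr fun j hj =>
      Function.update_of_ne (ne_of_mem_of_not_mem hj.2 hi') _ _

theorem IsHeap.demote (h : IsHeap L I s.key s.win) (hi : i < 2 ^ L) (hiI : i ∈ I) :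
    IsHeap L I (s.demote L i k).key (s.demote L i k).win := by
  have := h.setKey (k := k) hi
  rwa [Set.insert_eq_of_mem hiI] at this

theorem IsHeap.exists_max (h : IsHeap L I s.key s.win) (hI : ∀ i ∈ I, i < 2 ^ L)
    (hne : I.Nonempty) :
    ∃ i ∈ I, s.max = some (i, s.key i) ∧
      ∀ j ∈ I, s.key j < s.key i ∨ s.key j = s.key i ∧ j ≤ i := by
  have hroot := h 1 le_rfl (Nat.one_lt_two_pow L.succ_ne_zero)
  rw [Set.inter_eq_left.2 fun i hi => mem_subtree_one (hI i hi)] at hroot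
  unfold Store.max
  cases hw : s.win 1 with
  | none =>
    rw [hw] at hroot
    exact absurd hroot hne.ne_empty
  | some i =>
    rw [hw] at hroot
    exact ⟨i, hroot.1, rfl, hroot.2⟩

end Queue

/-! ### Rank and select -/

section Tables

variable {α γ : Type*} [DecidableEq γ] {S : ColoredString α γ} {y : γ} {s : Store α} {q m : ℕ}

theorem bit_zero : bit S y 0 = false := by
  simp [bit, ColoredString.colorAt]

theorem isGreatest_onesBefore_of_le_one (hq : q ≤ 1) : IsGreatest (onesBefore S y q) (-1) := by
  refine ⟨Set.mem_insert _ _, ?_⟩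
  rintro _ (rfl | ⟨p, hp, hbit, rfl⟩)
  · exact le_rfl
  · rw [Nat.lt_one_iff.1 (hp.trans_le hq), bit_zero] at hbit
    exact absurd hbit Bool.false_ne_true

theorem isGreatest_onesBefore_succ (hq : bit S y q = true) :
    IsGreatest (onesBefore S y (q + 1)) q := by
  refine ⟨Or.inr ⟨q, q.lt_succ_self, hq, rfl⟩, ?_⟩
  rintro _ (rfl | ⟨p, hp, -, rfl⟩) <;> omega

theorem onesBefore_succ_of_not (hq : ¬bit S y q = true) :
    onesBefore S y (q + 1) = onesBefore S y q := by
  ext x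
  refine or_congr_right ⟨?_, ?_⟩
  · rintro ⟨p, hp, hbit, rfl⟩
    refine ⟨p, lt_of_le_of_ne (Nat.le_of_lt_succ hp) ?_, hbit, rfl⟩
    rintro rfl
    exact hq hbit
  · rintro ⟨p, hp, hbit, rfl⟩
    exact ⟨p, by omega, hbit, rfl⟩

/-- The tables for rank and select are filled for the first `m` positions of the bitvector: for
`q ≤ m + 1`, `select (rank q)` is the last one before `q`. -/
structure IsScanned (S : ColoredString α γ) (y : γ) (m : ℕ) (s : Store α) : Prop where
  isGreatest : ∀ q ≤ m + 1, IsGreatest (onesBefore S y q) (s.select (s.rank q))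
  rank_le : ∀ q ≤ m + 1, s.rank q ≤ s.ones
  rank_last : s.rank (m + 1) = s.ones

theorem IsScanned.scan (h : IsScanned S y m s) :
    IsScanned S y (m + 1) (Store.scan S y s (m + 1)) := by
  have hlast := h.isGreatest (m + 1) le_rfl
  rw [h.rank_last] at hlast
  unfold Store.scan
  split_ifs with hbit
  · refine ⟨fun q hq => ?_, fun q hq => ?_, Function.update_self ..⟩ <;>
      rcases (show q ≤ m + 1 ∨ q = m + 1 + 1 by omega) with hqm | rfl
    · have := h.rank_le q hqm
      simp only [Function.update_of_ne (show q ≠ m + 1 + 1 by omega),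
        Function.update_of_ne (show s.rank q ≠ s.ones + 1 by omega)]
      exact h.isGreatest q hqm
    · simp only [Function.update_self]
      exact isGreatest_onesBefore_succ hbit
    · simp only [Function.update_of_ne (show q ≠ m + 1 + 1 by omega)]
      exact (h.rank_le q hqm).trans (Nat.le_succ _)
    · simp only [Function.update_self, le_refl]
  · refine ⟨fun q hq => ?_, fun q hq => ?_, Function.update_self ..⟩ <;>
      rcases (show q ≤ m + 1 ∨ q = m + 1 + 1 by omega) with hqm | rfl <;>
      simp only [Store.tick]
    · simp only [Function.update_of_ne (show q ≠ m + 1 + 1 by omega)]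
      exact h.isGreatest q hqm
    · simp only [Function.update_self]
      rwa [onesBefore_succ_of_not hbit]
    · simp only [Function.update_of_ne (show q ≠ m + 1 + 1 by omega)]
      exact h.rank_le q hqm
    · simp only [Function.update_self, le_refl]

theorem scan_eq (q : ℕ) : Store.scan S y s q = { s with
    rank := (Store.scan S y s q).rank
    select := (Store.scan S y s q).select
    ones := (Store.scan S y s q).ones
    time := s.time + 1 } := by
  unfold Store.scan Store.tick
  split_ifs <;> rfl

theorem preprocess_eq (s : Store α) : Store.preprocess S y s = { s with
    rank := (Store.preprocess S y s).rank
    select := (Store.preprocess S y s).select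
    ones := (Store.preprocess S y s).ones
    time := s.time + 2 * S.len } := by
  unfold Store.preprocess
  induction 2 * S.len with
  | zero => rfl
  | succ m ih =>
    simp only [List.range_succ, List.foldl_append, List.foldl_cons, List.foldl_nil]
    refine (scan_eq _).trans ?_
    rw [ih]
    rfl

theorem isScanned_preprocess :
    IsScanned S y (2 * S.len) (Store.preprocess S y (Store.empty : Store α)) := by
  unfold Store.preprocess
  induction 2 * S.len with
  | zero => exact ⟨fun q hq => isGreatest_onesBefore_of_le_one hq, fun _ _ => le_rfl, rfl⟩
  | succ m ih =>
    simp only [List.range_succ, List.foldl_append, List.foldl_cons, List.foldl_nil]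
    exact ih.scan

end Tables

/-! ### Demotions and their cost -/

section QueueRuns

variable {α : Type*} {ord : List (Node α)} {s s' s'' : Store α} {c c' k : ℤ} {i : ℕ}

/-- The number of demotions of all indices. -/
def totalDemotes (ord : List (Node α)) (s : Store α) : ℕ :=
  ∑ i ∈ Finset.range ord.length, s.demotes i

/-- The potential of the amortized analysis: the number of steps other than idle visits, minus an
allowance of `levels ord + 6` steps for every demotion. -/
def excess (ord : List (Node α)) (s : Store α) : ℤ :=
  s.time - s.idle - (levels ord + 6) * totalDemotes ord s

/-- `s'` arises from `s` by demotions and visits of nodes that increase `excess` by at most `c`. -/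
structure QueueRun (ord : List (Node α)) (c : ℤ) (s s' : Store α) : Prop where
  rank : s'.rank = s.rank
  select : s'.select = s.select
  ones : s'.ones = s.ones
  leftMinimal : s'.leftMinimal = s.leftMinimal
  out : s'.out = s.out
  demotes_le : ∀ i, s.demotes i ≤ s'.demotes i
  isHeap : IsHeap (levels ord) (Set.Iio ord.length) s.key s.win →
    IsHeap (levels ord) (Set.Iio ord.length) s'.key s'.win
  excess_le : excess ord s' ≤ excess ord s + c

theorem QueueRun.refl (s : Store α) : QueueRun ord 0 s s :=
  ⟨rfl, rfl, rfl, rfl, rfl, fun _ => le_rfl, id, (add_zero _).ge⟩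

theorem QueueRun.trans (h : QueueRun ord c s s') (h' : QueueRun ord c' s' s'') :
    QueueRun ord (c + c') s s'' where
  rank := h'.rank.trans h.rank
  select := h'.select.trans h.select
  ones := h'.ones.trans h.ones
  leftMinimal := h'.leftMinimal.trans h.leftMinimal
  out := h'.out.trans h.out
  demotes_le i := (h.demotes_le i).trans (h'.demotes_le i)
  isHeap := h'.isHeap ∘ h.isHeap
  excess_le := by linarith [h.excess_le, h'.excess_le]

theorem QueueRun.mono (h : QueueRun ord c s s') (hc : c ≤ c') : QueueRun ord c' s s' :=
  { h with excess_le := by linarith [h.excess_le] }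

theorem QueueRun.totalDemotes_le (h : QueueRun ord c s s') :
    totalDemotes ord s ≤ totalDemotes ord s' :=
  Finset.sum_le_sum fun i _ => h.demotes_le i

theorem QueueRun.isScanned {γ : Type*} [DecidableEq γ] {S : ColoredString α γ} {y : γ} {m : ℕ}
    (h : QueueRun ord c s s') (hs : IsScanned S y m s) : IsScanned S y m s' := by
  refine ⟨?_, ?_, ?_⟩ <;> rw [h.rank]
  · rw [h.select]
    exact hs.isGreatest
  · rw [h.ones]
    exact hs.rank_le
  · rw [h.ones]
    exact hs.rank_last

theorem excess_tick (s : Store α) : excess ord s.tick = excess ord s + 1 := by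
  simp only [excess, Store.tick, totalDemotes, Nat.cast_add, Nat.cast_one]
  ring

theorem queueRun_tick (s : Store α) : QueueRun ord 1 s s.tick :=
  ⟨rfl, rfl, rfl, rfl, rfl, fun _ => le_rfl, id, (excess_tick s).le⟩

theorem queueRun_idle (s : Store α) : QueueRun ord 0 s { s.tick with idle := s.idle + 1 } := by
  refine ⟨rfl, rfl, rfl, rfl, rfl, fun _ => le_rfl, id, ?_⟩
  simp only [excess, Store.tick, totalDemotes, Nat.cast_add, Nat.cast_one]
  linarith

theorem length_le_two_pow_levels (ord : List (Node α)) : ord.length ≤ 2 ^ levels ord :=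
  Nat.le_pow_clog one_lt_two _

theorem totalDemotes_demote (hi : i < ord.length) (L : ℕ) :
    totalDemotes ord (s.demote L i k) = totalDemotes ord s + 1 := by
  simp only [totalDemotes, demote_eq, Finset.sum_update_of_mem (Finset.mem_range.2 hi)]
  rw [← Finset.add_sum_erase _ s.demotes (Finset.mem_range.2 hi), Finset.sdiff_singleton_eq_erase]
  ring

theorem queueRun_demote (hi : i < ord.length) :
    QueueRun ord (-5) s (s.demote (levels ord) i k) where
  rank := by rw [demote_eq]
  select := by rw [demote_eq]
  ones := by rw [demote_eq]
  leftMinimal := by rw [demote_eq]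
  out := by rw [demote_eq]
  demotes_le j := by
    rw [demote_eq]
    rcases eq_or_ne j i with rfl | hji
    · simp only [Function.update_self, Nat.le_add_right]
    · simp only [Function.update_of_ne hji, le_refl]
  isHeap h := h.demote (hi.trans_le (length_le_two_pow_levels ord)) hi
  excess_le := by
    rw [excess, totalDemotes_demote hi, demote_eq, excess]
    push_cast
    linarith

end QueueRuns

section Demotions

variable {α : Type*} [DecidableEq α] {ord : List (Node α)} {s s' s'' : Store α} {c c' k : ℤ}
  {u w : Node α} {f : Node α → ℤ} {A B : Set (Node α)}

/-- The key of a node. -/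
def nodeKey (ord : List (Node α)) (s : Store α) (u : Node α) : ℤ := s.key (iBFS ord u)

/-- The number of demotions of a node. -/
def nodeDemotes (ord : List (Node α)) (s : Store α) (u : Node α) : ℕ := s.demotes (iBFS ord u)

theorem nodeKey_demote_self : nodeKey ord (s.demote (levels ord) (iBFS ord u) k) u = k := by
  simp only [nodeKey, demote_eq, Function.update_self]

theorem nodeDemotes_demote_self :
    nodeDemotes ord (s.demote (levels ord) (iBFS ord u) k) u = nodeDemotes ord s u + 1 := by
  simp only [nodeDemotes, demote_eq, Function.update_self]

theorem nodeKey_demote_of_ne (hu : u ∈ ord) (hw : w ∈ ord) (h : w ≠ u) :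
    nodeKey ord (s.demote (levels ord) (iBFS ord u) k) w = nodeKey ord s w := by
  simp only [nodeKey, demote_eq, Function.update_of_ne fun h' => h (iBFS_inj hw hu h')]

theorem nodeDemotes_demote_of_ne (hu : u ∈ ord) (hw : w ∈ ord) (h : w ≠ u) :
    nodeDemotes ord (s.demote (levels ord) (iBFS ord u) k) w = nodeDemotes ord s w := by
  simp only [nodeDemotes, demote_eq, Function.update_of_ne fun h' => h (iBFS_inj hw hu h')]

/-- A run of the queue in which each node `w` of `A` is demoted once, to `f w`, and no other node is
demoted. -/
structure Demoted (ord : List (Node α)) (f : Node α → ℤ) (c : ℤ) (A : Set (Node α))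
    (s s' : Store α) : Prop extends QueueRun ord c s s' where
  idle_eq : s'.idle = s.idle
  key_of_mem : ∀ w ∈ ord, w ∈ A → nodeKey ord s' w = f w
  key_of_notMem : ∀ w ∈ ord, w ∉ A → nodeKey ord s' w = nodeKey ord s w
  demotes_of_mem : ∀ w ∈ ord, w ∈ A → nodeDemotes ord s' w = nodeDemotes ord s w + 1
  demotes_of_notMem : ∀ w ∈ ord, w ∉ A → nodeDemotes ord s' w = nodeDemotes ord s w

theorem demoted_refl (f : Node α → ℤ) (s : Store α) : Demoted ord f 0 ∅ s s :=
  { QueueRun.refl s with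
    idle_eq := rfl
    key_of_mem := fun _ _ hw => hw.elim
    key_of_notMem := fun _ _ _ => rfl
    demotes_of_mem := fun _ _ hw => hw.elim
    demotes_of_notMem := fun _ _ _ => rfl }

theorem demoted_tick (f : Node α → ℤ) (s : Store α) : Demoted ord f 1 ∅ s s.tick :=
  { queueRun_tick s with
    idle_eq := rfl
    key_of_mem := fun _ _ hw => hw.elim
    key_of_notMem := fun _ _ _ => rfl
    demotes_of_mem := fun _ _ hw => hw.elim
    demotes_of_notMem := fun _ _ _ => rfl }

theorem demoted_demote (hu : u ∈ ord) (s : Store α) :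
    Demoted ord f (-5) {u} s (s.demote (levels ord) (iBFS ord u) (f u)) :=
  { queueRun_demote (iBFS_lt hu) with
    idle_eq := by rw [demote_eq]
    key_of_mem := by
      rintro w - rfl
      exact nodeKey_demote_self
    key_of_notMem := fun w hw hwu => nodeKey_demote_of_ne hu hw hwu
    demotes_of_mem := by
      rintro w - rfl
      exact nodeDemotes_demote_self
    demotes_of_notMem := fun w hw hwu => nodeDemotes_demote_of_ne hu hw hwu }

theorem Demoted.trans (h : Demoted ord f c A s s') (h' : Demoted ord f c' B s' s'')
    (hAB : Disjoint A B) : Demoted ord f (c + c') (A ∪ B) s s'' where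
  toQueueRun := h.toQueueRun.trans h'.toQueueRun
  idle_eq := h'.idle_eq.trans h.idle_eq
  key_of_mem w hw hwAB := by
    by_cases hwB : w ∈ B
    · exact h'.key_of_mem w hw hwB
    · exact (h'.key_of_notMem w hw hwB).trans (h.key_of_mem w hw (hwAB.resolve_right hwB))
  key_of_notMem w hw hwAB :=
    (h'.key_of_notMem w hw fun hwB => hwAB (Or.inr hwB)).trans
      (h.key_of_notMem w hw fun hwA => hwAB (Or.inl hwA))
  demotes_of_mem w hw hwAB := by
    rcases hwAB with hwA | hwB
    · rw [h'.demotes_of_notMem w hw (Set.disjoint_left.1 hAB hwA), h.demotes_of_mem w hw hwA]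
    · rw [h'.demotes_of_mem w hw hwB, h.demotes_of_notMem w hw (Set.disjoint_right.1 hAB hwB)]
  demotes_of_notMem w hw hwAB :=
    (h'.demotes_of_notMem w hw fun hwB => hwAB (Or.inr hwB)).trans
      (h.demotes_of_notMem w hw fun hwA => hwAB (Or.inl hwA))

theorem Demoted.congr (h : Demoted ord f c A s s') (hc : c ≤ c')
    (hAB : ∀ w ∈ ord, w ∈ A ↔ w ∈ B) : Demoted ord f c' B s s' where
  toQueueRun := h.toQueueRun.mono hc
  idle_eq := h.idle_eq
  key_of_mem w hw hwB := h.key_of_mem w hw ((hAB w hw).2 hwB)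
  key_of_notMem w hw hwB := h.key_of_notMem w hw (mt (hAB w hw).1 hwB)
  demotes_of_mem w hw hwB := h.demotes_of_mem w hw ((hAB w hw).2 hwB)
  demotes_of_notMem w hw hwB := h.demotes_of_notMem w hw (mt (hAB w hw).1 hwB)

theorem Demoted.totalDemotes_lt (h : Demoted ord f c A s s') (hu : u ∈ ord) (huA : u ∈ A) :
    totalDemotes ord s < totalDemotes ord s' := by
  refine Finset.sum_lt_sum (fun i _ => h.demotes_le i)
    ⟨iBFS ord u, Finset.mem_range.2 (iBFS_lt hu), ?_⟩
  have := h.demotes_of_mem u hu huA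
  unfold nodeDemotes at this
  omega

end Demotions

section Recursion

variable {α γ : Type*} [DecidableEq α] [DecidableEq γ] {S : ColoredString α γ} {y : γ}
  {ord : List (Node α)} {s : Store α} {u w : Node α} {ℓ m depth : ℕ} {f : Node α → ℤ}

theorem demoted_foldl {F : Node α → Store α → ℤ × Store α} {cs : List (Node α)}
    (hF : ∀ v ∈ cs, ∀ s, IsScanned S y m s →
      (F v s).1 = f v ∧ Demoted ord f (-1) {w | v <+: w} s (F v s).2)
    (hcs : cs.Pairwise fun v v' => ∀ w, v <+: w → ¬v' <+: w) (a : ℤ × Store α)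
    (ha : IsScanned S y m a.2) :
    let r := cs.foldl (fun (a : ℤ × Store α) v =>
      let b := F v a.2.tick
      (if b.1 < a.1 then b.1 else a.1, b.2)) a
    (∀ x, x ≤ r.1 ↔ x ≤ a.1 ∧ ∀ v ∈ cs, x ≤ f v) ∧
      Demoted ord f 0 {w | ∃ v ∈ cs, v <+: w} a.2 r.2 := by
  induction cs generalizing a with
  | nil =>
    refine ⟨by simp, (demoted_refl f a.2).congr le_rfl fun w _ => ?_⟩
    simp
  | cons v cs ih =>
    rw [List.pairwise_cons] at hcs
    rw [List.foldl_cons]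
    obtain ⟨hval, hdem⟩ := hF v List.mem_cons_self a.2.tick 
      ((queueRun_tick (ord := ord) a.2).isScanned ha)
    have hstep := (demoted_tick f a.2).trans hdem (Set.empty_disjoint _)
    obtain ⟨hval', hdem'⟩ := ih (fun v' hv' => hF v' (List.mem_cons_of_mem v hv')) hcs.2
      (if (F v a.2.tick).1 < a.1 then (F v a.2.tick).1 else a.1, (F v a.2.tick).2)
      (hstep.isScanned ha)
    constructor
    · intro x
      rw [hval', List.forall_mem_cons, ← and_assoc, ← hval]
      refine and_congr_left fun _ => ?_
      simp only
      split_ifs <;> omega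
    · refine (hstep.trans hdem' ?_).congr (by norm_num) fun w _ => ?_
      · rw [Set.empty_union, Set.disjoint_left]
        rintro w hvw ⟨v', hv', hvw'⟩
        exact hcs.1 v' hv' w hvw hvw'
      · simp

theorem demoted_hProc_of_isLeaf (ho : IsLevelOrder S ord) (hu : IsLeaf S u)
    (hs : IsScanned S y (2 * S.len) s) (hℓ : ℓ ≤ S.len + 1) :
    (hProc S ord (depth + 1) u ℓ s).1 = demotedKey S y ℓ u ∧
      Demoted ord (demotedKey S y ℓ) (-4) {w | u <+: w} s (hProc S ord (depth + 1) u ℓ s).2 := by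
  have hlen := hu.length_le
  have hpos := hu.length_pos
  rw [hProc, if_pos hu]
  simp only
  rw [show S.len + 1 - leafNumber S u = u.length - 1 by unfold leafNumber; omega,
    ← demotedKey_eq_of_isLeaf hu (hs.isGreatest _ (by omega))]
  have humem := (ho.mem_iff u).2 hu.isNode
  refine ⟨rfl, ((demoted_tick _ s).trans (demoted_demote humem s.tick)
    (Set.empty_disjoint _)).congr (by norm_num) fun w hw => ?_⟩
  rw [Set.empty_union, Set.mem_singleton_iff, Set.mem_ofPred_eq]
  exact ⟨fun h => h ▸ List.prefix_rfl,
    fun h => hu.eq_of_prefix ((ho.mem_iff w).1 hw).infix_text h⟩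

theorem demoted_hProc (ho : IsLevelOrder S ord) (hu : IsNode S u)
    (hs : IsScanned S y (2 * S.len) s) (hℓ : ℓ ≤ S.len + 1)
    (hdepth : S.len + 2 ≤ depth + u.length) :
    (hProc S ord depth u ℓ s).1 = demotedKey S y ℓ u ∧
      Demoted ord (demotedKey S y ℓ) (-4) {w | u <+: w} s (hProc S ord depth u ℓ s).2 := by
  induction depth generalizing u s with
  | zero => have := hu.length_le; omega
  | succ depth ih =>
    by_cases hleaf : IsLeaf S u
    · exact demoted_hProc_of_isLeaf ho hleaf hs hℓ
    have hlen : ∀ v ∈ children S ord u, u.length < v.length := fun v hv =>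
      length_lt_of_prefix_of_ne (prefix_of_mem_children ho hv) (ne_of_mem_children ho hv)
    obtain ⟨hval, hdem⟩ := demoted_foldl (f := demotedKey S y ℓ) (ord := ord)
      (F := fun v => hProc S ord depth v ℓ) (cs := children S ord u)
      (fun v hv s hs => (ih (isNode_of_mem_children ho hv) hs
        (by have := hlen v hv; omega)).imp_right fun h => h.congr (by norm_num) fun _ _ => Iff.rfl)
      ((nodup_children ho u).imp_of_mem fun hv hv' hne w hvw hvw' =>
        hne (eq_of_mem_children_of_prefix ho hv hv' hvw hvw'))
      ((ℓ : ℤ) - 1, s.tick) ((queueRun_tick (ord := ord) s).isScanned hs)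
    rw [hProc, if_neg hleaf]
    simp only
    have hmin := eq_of_forall_le_iff fun x => (hval x).trans
      ((and_congr_left' Int.le_sub_one_iff).trans (le_demotedKey_iff_children ho hu hleaf).symm)
    rw [hmin]
    refine ⟨rfl, (((demoted_tick _ s).trans hdem (Set.empty_disjoint _)).trans
      (demoted_demote ((ho.mem_iff u).2 hu) _) ?_).congr (by norm_num) fun w hw => ?_⟩
    · rw [Set.empty_union, Set.disjoint_singleton_right]
      rintro ⟨v, hv, hvu⟩
      exact (hlen v hv).not_ge hvu.length_le
    · rw [Set.empty_union]
      constructor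
      · rintro (⟨v, hv, hvw⟩ | rfl)
        · exact (prefix_of_mem_children ho hv).trans hvw
        · exact List.prefix_rfl
      · intro huw
        rcases eq_or_ne u w with rfl | hne
        · exact Or.inr rfl
        · exact Or.inl (exists_mem_children_prefix ho hu ((ho.mem_iff w).1 hw) huw hne)

end Recursion

section Ancestors

variable {α : Type*} [DecidableEq α] {ord vs : List (Node α)} {s s' s'' : Store α} {c c' m : ℤ}
  {v w : Node α} {brk : Bool}

/-- The effect of lowering the keys of `vs` to at most `m`. -/
structure Capped (ord : List (Node α)) (brk : Bool) (m : ℤ) (vs : List (Node α))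
    (s s' : Store α) : Prop extends QueueRun ord 0 s s' where
  key_of_mem : ∀ w ∈ vs, nodeKey ord s' w = min (nodeKey ord s w) m
  key_of_notMem : ∀ w ∈ ord, w ∉ vs → nodeKey ord s' w = nodeKey ord s w
  demotes_add_key_le : ∀ w ∈ ord, nodeDemotes ord s' w + nodeKey ord s' w ≤
    nodeDemotes ord s w + nodeKey ord s w
  idle_le : brk = true → s'.idle ≤ s.idle + 1

theorem capped_of_forall_le (h : QueueRun ord 0 s s') (hkey : s'.key = s.key)
    (hdem : s'.demotes = s.demotes) (hidle : s'.idle ≤ s.idle + 1)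
    (hle : ∀ w ∈ vs, nodeKey ord s w ≤ m) : Capped ord brk m vs s s' where
  toQueueRun := h
  key_of_mem w hw := by
    rw [min_eq_left (hle w hw), nodeKey, hkey, nodeKey]
  key_of_notMem w _ _ := by rw [nodeKey, hkey, nodeKey]
  demotes_add_key_le w _ := by rw [nodeKey, nodeDemotes, hkey, hdem, nodeKey, nodeDemotes]
  idle_le _ := hidle

theorem Capped.cons_of_lt (hv : v ∈ ord) (hvs : ∀ w ∈ vs, w ∈ ord) (hnotMem : v ∉ vs)
    (hm : m < nodeKey ord s v)
    (h : Capped ord brk m vs (s.tick.demote (levels ord) (iBFS ord v) m) s') :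
    Capped ord brk m (v :: vs) s s' := by
  have hdem := (demoted_tick (fun _ => m) s).trans (demoted_demote hv s.tick) (Set.empty_disjoint _)
  rw [Set.empty_union] at hdem
  have hkey : ∀ w ∈ ord, w ≠ v → _ := fun w hw hwv => hdem.key_of_notMem w hw hwv
  refine
    { toQueueRun := (hdem.toQueueRun.trans h.toQueueRun).mono (by norm_num)
      key_of_mem := List.forall_mem_cons.2 ⟨?_, fun w hw => ?_⟩
      key_of_notMem := fun w hw hwv => ?_
      demotes_add_key_le := fun w hw => (h.demotes_add_key_le w hw).trans ?_
      idle_le := fun hbrk => (h.idle_le hbrk).trans_eq (by rw [hdem.idle_eq]) }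
  · rw [h.key_of_notMem v hv hnotMem, hdem.key_of_mem v hv rfl, min_eq_right hm.le]
  · rw [h.key_of_mem w hw, hkey w (hvs w hw) (ne_of_mem_of_not_mem hw hnotMem)]
  · rw [List.mem_cons, not_or] at hwv
    rw [h.key_of_notMem w hw hwv.2, hkey w hw hwv.1]
  · rcases eq_or_ne w v with rfl | hwv
    · rw [hdem.key_of_mem w hw rfl, hdem.demotes_of_mem w hw rfl]
      push_cast
      omega
    · rw [hkey w hw hwv, hdem.demotes_of_notMem w hw hwv]

theorem Capped.cons_of_le (hv : v ∈ ord) (hnotMem : v ∉ vs) (hm : nodeKey ord s v ≤ m)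
    (h : Capped ord false m vs { s.tick with idle := s.idle + 1 } s') :
    Capped ord false m (v :: vs) s s' where
  toQueueRun := ((queueRun_idle s).trans h.toQueueRun).mono le_rfl
  key_of_mem := List.forall_mem_cons.2 ⟨by
    rw [h.key_of_notMem v hv hnotMem, min_eq_left hm]
    rfl, h.key_of_mem⟩
  key_of_notMem w hw hwv := h.key_of_notMem w hw fun hwvs => hwv (List.mem_cons_of_mem v hwvs)
  demotes_add_key_le := h.demotes_add_key_le
  idle_le hbrk := absurd hbrk Bool.false_ne_true

theorem capped_updateAncestors (brk : Bool) (m : ℤ) (hvs : ∀ v ∈ vs, v ∈ ord) (hnodup : vs.Nodup)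
    (hkey : vs.Pairwise fun v w => nodeKey ord s w ≤ nodeKey ord s v) :
    Capped ord brk m vs s (updateAncestors ord brk m vs s) := by
  induction vs generalizing s with
  | nil =>
    exact capped_of_forall_le (QueueRun.refl s) rfl rfl (Nat.le_succ _) fun _ hw => by
      cases hw
  | cons v vs ih =>
    rw [List.forall_mem_cons] at hvs
    rw [List.nodup_cons] at hnodup
    rw [List.pairwise_cons] at hkey
    unfold updateAncestors
    split_ifs with hm hbrk
    · refine Capped.cons_of_lt hvs.1 hvs.2 hnodup.1 hm (ih hvs.2 hnodup.2 ?_)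
      have hne : ∀ w ∈ vs, w ≠ v := fun w hw => ne_of_mem_of_not_mem hw hnodup.1
      refine hkey.2.imp_of_mem fun {a b} ha hb hab => ?_
      rwa [nodeKey_demote_of_ne hvs.1 (hvs.2 a ha) (hne a ha),
        nodeKey_demote_of_ne hvs.1 (hvs.2 b hb) (hne b hb)]
    · have hvm : nodeKey ord s v ≤ m := not_lt.1 hm
      exact capped_of_forall_le (queueRun_idle s) rfl rfl le_rfl <|
        List.forall_mem_cons.2 ⟨hvm, fun w hw => (hkey.1 w hw).trans hvm⟩
    · obtain rfl := Bool.eq_false_of_not_eq_true hbrk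
      exact Capped.cons_of_le hvs.1 hnodup.1 (not_lt.1 hm) (ih hvs.2 hnodup.2 hkey.2)

end Ancestors

/-! ### One iteration -/

section Iteration

variable {α γ : Type*} [DecidableEq α] {S : ColoredString α γ}
  {ord : List (Node α)} {brk : Bool} {s s' : Store α} {u w : Node α} {d e : ℕ} {T : List α}

theorem exists_hasTopKey (ho : IsLevelOrder S ord)
    (h : IsHeap (levels ord) (Set.Iio ord.length) s.key s.win) (hneg : s.allNegative = false) :
    ∃ u d, HasTopKey S (nodeKey ord s) u d ∧ s.max = some (iBFS ord u, (d : ℤ)) := by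
  have hroot : ([] : Node α) ∈ ord := (ho.mem_iff _).2 isNode_nil
  obtain ⟨i, hi, hmax, hbest⟩ := h.exists_max
    (fun i hi => hi.trans_le (length_le_two_pow_levels ord)) ⟨_, iBFS_lt hroot⟩
  have hk : 0 ≤ s.key i := by
    simpa only [Store.allNegative, hmax, decide_eq_false_iff_not, not_lt] using hneg
  obtain ⟨d, hd⟩ := Int.eq_ofNat_of_zero_le hk
  have hu := (ho.mem_iff _).1 (nodeOf_mem hi)
  have hindex := iBFS_nodeOf ho.nodup hi
  have hbest' : ∀ w, IsNode S w → s.key (iBFS ord w) < s.key i ∨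
      s.key (iBFS ord w) = s.key i ∧ iBFS ord w ≤ i :=
    fun w hw => hbest _ (iBFS_lt ((ho.mem_iff w).2 hw))
  rw [← hindex] at hmax hbest' hd
  rw [hd] at hmax hbest'
  refine ⟨nodeOf ord i, d, ⟨hu, hd, fun w hw => ?_, fun w hw hwu hne => ?_⟩, hmax⟩
  · exact (hbest' w hw).elim le_of_lt fun h => h.1.le
  · exact (hbest' w hw).resolve_right fun h => h.2.not_gt (iBFS_lt_of_prefix ho hw hu hwu hne)

theorem key_neg_of_allNegative (h : IsHeap (levels ord) (Set.Iio ord.length) s.key s.win)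
    (hneg : s.allNegative = true) (hw : w ∈ ord) : nodeKey ord s w < 0 := by
  obtain ⟨i, -, hmax, hbest⟩ := h.exists_max
    (fun i hi => hi.trans_le (length_le_two_pow_levels ord)) ⟨_, iBFS_lt hw⟩
  simp only [Store.allNegative, hmax, decide_eq_true_eq] at hneg
  exact ((hbest _ (iBFS_lt hw)).elim le_of_lt fun h => h.1.le).trans_lt hneg

theorem iteration_eq (ho : IsLevelOrder S ord) (hu : IsNode S u)
    (hmax : s.max = some (iBFS ord u, (d : ℤ))) :
    iteration S ord brk s =
      let r := hProc S ord (S.len + 2) u d (record ord u d (report S ord u d s.tick))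
      updateAncestors ord brk r.1 (ancestors S u) r.2 := by
  have huo := (ho.mem_iff u).2 hu
  have hnode : nodeOf ord (iBFS ord u) = u :=
    iBFS_inj (nodeOf_mem (iBFS_lt huo)) huo (iBFS_nodeOf ho.nodup (iBFS_lt huo))
  unfold iteration
  rw [hmax]
  simp only [hnode, Int.toNat_natCast]

theorem report_eq (u : Node α) (d : ℕ) (s : Store α) :
    report S ord u d s =
      { s with out := (report S ord u d s).out, time := s.time + 1 } := by
  unfold report Store.tick
  split
  · split_ifs <;> rfl
  · rfl

theorem record_report_eq (u : Node α) (d : ℕ) (s : Store α) :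
    record ord u d (report S ord u d s) = { s with
      leftMinimal := (record ord u d s).leftMinimal
      out := (report S ord u d s).out
      time := s.time + 2 } := by
  rw [report_eq]
  rfl

theorem mem_out_report : (T, e) ∈ (report S ord u d s).out ↔
    (T, e) ∈ s.out ∨ e = d ∧ ∃ v, parent S u = some v ∧ leftMin S u = some T ∧
      s.leftMinimal ((d + 1) % 2) (iBFS ord (slinkNode S ord u v)) ≠ some (d + 1) := by
  unfold report
  cases hv : parent S u with
  | none => simp [Store.tick]
  | some v =>
    cases hT : leftMin S u with
    | none => simp [Store.tick]
    | some T' =>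
      simp only
      split_ifs with hR
      · simp [Store.tick, hR]
      · simp only [List.mem_cons, Prod.mk.injEq, Option.some.injEq, exists_eq_left', ne_eq, hR,
          not_false_eq_true, and_true]
        rw [or_comm, and_comm (a := e = d), eq_comm (a := T)]

theorem leftMinimal_record (hu : u ∈ ord) (hw : w ∈ ord) (d p : ℕ) (s : Store α) :
    (record ord u d s).leftMinimal p (iBFS ord w) =
      if p = d % 2 ∧ w = u then some d else s.leftMinimal p (iBFS ord w) := by
  have hindex : iBFS ord w = iBFS ord u ↔ w = u := ⟨iBFS_inj hw hu, fun h => h ▸ rfl⟩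
  simp only [record, Function.update_apply, ite_apply, ite_and, ← hindex]
  split_ifs with hp <;> simp only [hp]

variable [DecidableEq γ] {y : γ}

/-- The effect of the recursion `h(u,d)` and of the subsequent loop over the ancestors of `u`. -/
structure SkipStep (S : ColoredString α γ) (y : γ) (ord : List (Node α)) (brk : Bool)
    (u : Node α) (d : ℕ) (s s' : Store α) : Prop extends QueueRun ord (-4) s s' where
  key_eq : ∀ w, IsNode S w → nodeKey ord s' w = skipKey S y (nodeKey ord s) u d w
  demotes_add_key_le : ∀ w, IsNode S w → nodeDemotes ord s' w + nodeKey ord s' w ≤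
    nodeDemotes ord s w + nodeKey ord s w
  totalDemotes_lt : totalDemotes ord s < totalDemotes ord s'
  idle_le : brk = true → s'.idle ≤ s.idle + 1

theorem skipStep_of_demoted_of_capped (ho : IsLevelOrder S ord) {r : Store α}
    (hK : KeyInv S y (nodeKey ord s)) (hu : HasTopKey S (nodeKey ord s) u d)
    (hdem : Demoted ord (demotedKey S y d) (-4) {w | u <+: w} s r)
    (hcap : Capped ord brk (demotedKey S y d u) (ancestors S u) r s') :
    SkipStep S y ord brk u d s s' where
  toQueueRun := hdem.toQueueRun.trans hcap.toQueueRun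
  key_eq w hw := by
    have hwo := (ho.mem_iff w).2 hw
    have hanc : w ∈ ancestors S u ↔ ¬ u <+: w ∧ w <+: u := mem_ancestors.trans
      ⟨fun h => ⟨fun huw => h.2.2 (h.2.1.eq_of_length_le huw.length_le), h.2.1⟩,
        fun h => ⟨hw, h.2, fun heq => h.1 (heq ▸ List.prefix_rfl)⟩⟩
    unfold skipKey
    split_ifs with huw hwu
    · rw [hcap.key_of_notMem w hwo fun h => (hanc.1 h).1 huw, hdem.key_of_mem w hwo huw]
    · rw [hcap.key_of_mem w (hanc.2 ⟨huw, hwu⟩), hdem.key_of_notMem w hwo huw]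
    · rw [hcap.key_of_notMem w hwo fun h => hwu (hanc.1 h).2, hdem.key_of_notMem w hwo huw]
  demotes_add_key_le w hw := by
    have hwo := (ho.mem_iff w).2 hw
    refine (hcap.demotes_add_key_le w hwo).trans ?_
    by_cases huw : u <+: w
    · have hlt : demotedKey S y d w < d := demotedKey_lt
      rw [hdem.key_of_mem w hwo huw, hdem.demotes_of_mem w hwo huw,
        hK.key_eq_of_prefix hu hw huw]
      push_cast
      linarith
    · rw [hdem.key_of_notMem w hwo huw, hdem.demotes_of_notMem w hwo huw]
  totalDemotes_lt := (hdem.totalDemotes_lt ((ho.mem_iff u).2 hu.isNode) List.prefix_rfl).trans_le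
    hcap.totalDemotes_le
  idle_le hbrk := hdem.idle_eq ▸ hcap.idle_le hbrk

theorem skipStep_updateAncestors_hProc (ho : IsLevelOrder S ord) (brk : Bool)
    (hs : IsScanned S y (2 * S.len) s) (hK : KeyInv S y (nodeKey ord s))
    (hu : HasTopKey S (nodeKey ord s) u d) (hd : d ≤ S.len + 1) :
    let r := hProc S ord (S.len + 2) u d s
    SkipStep S y ord brk u d s (updateAncestors ord brk r.1 (ancestors S u) r.2) := by
  intro r
  obtain ⟨hval, hdem⟩ := demoted_hProc ho hu.isNode hs hd (Nat.le_add_right _ u.length)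
  have hkey : ∀ p ∈ ancestors S u, nodeKey ord r.2 p = nodeKey ord s p := fun p hp => by
    obtain ⟨hpn, hpu, hne⟩ := mem_ancestors.1 hp
    exact hdem.key_of_notMem p ((ho.mem_iff p).2 hpn) fun hup =>
      hne (hpu.eq_of_length_le hup.length_le)
  have hcap := capped_updateAncestors (s := r.2) brk (demotedKey S y d u)
    (fun p hp => (ho.mem_iff p).2 (mem_ancestors.1 hp).1)
    ((pairwise_ancestors S u).imp fun h => h.2.symm)
    ((pairwise_ancestors S u).imp_of_mem fun {p q} hp hq hqp => by
      rw [hkey p hp, hkey q hq]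
      exact hK.mono q p (mem_ancestors.1 hq).1 (mem_ancestors.1 hp).1 hqp.1)
  rw [show r.1 = demotedKey S y d u from hval]
  exact skipStep_of_demoted_of_capped ho hK hu hdem hcap

theorem mem_out_report_iff_leftMinimal (ho : IsLevelOrder S ord)
    (hK : KeyInv S y (nodeKey ord s))
    (hR : RecordInv S y (nodeKey ord s) fun p w => s.leftMinimal p (iBFS ord w))
    (hu : HasTopKey S (nodeKey ord s) u d) :
    (T, e) ∈ (report S ord u d s).out ↔ (T, e) ∈ s.out ∨ e = d ∧ ∃ v, parent S u = some v ∧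
      leftMin S u = some T ∧ ¬LeftMinimal S y (d + 1) (slinkNode S ord u v) := by
  refine mem_out_report.trans (or_congr_right (and_congr_right fun _ => exists_congr fun v =>
    and_congr_right fun hv => and_congr_right fun _ => not_congr ?_))
  have hd := (hK.leftMinimal hu).le_len (ne_nil_of_parent_eq_some hv)
  exact hR.eq_some_succ_iff hu hd (isNode_locusNode ho _)

end Iteration

/-! ### The main loop -/

section MainLoop

variable {α γ : Type*} [DecidableEq α] [DecidableEq γ] {S : ColoredString α γ} {y : γ}
  {ord : List (Node α)} {brk : Bool} {s s' : Store α} {u w : Node α} {d : ℕ}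

/-- The invariant of the main loop. By `demotes_add_key_le`, a demotion of a node is paid for by a
decrease of its key, which falls from `n + 1` to at least `-1`; by `excess_le`, the demotions pay
for all later steps other than idle visits. -/
structure LoopInv (S : ColoredString α γ) (y : γ) (ord : List (Node α)) (brk : Bool)
    (s : Store α) : Prop where
  isHeap : IsHeap (levels ord) (Set.Iio ord.length) s.key s.win
  isScanned : IsScanned S y (2 * S.len) s
  keyInv : KeyInv S y (nodeKey ord s)
  recordInv : RecordInv S y (nodeKey ord s) fun p w => s.leftMinimal p (iBFS ord w)
  demotes_add_key_le : ∀ w, IsNode S w → nodeDemotes ord s w + nodeKey ord s w ≤ S.len + 1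
  mem_out : ∀ T d, (T, d) ∈ s.out ↔ ∃ u v, IsNode S u ∧ parent S u = some v ∧
    leftMin S u = some T ∧ Extracted S y (nodeKey ord s) u d ∧
    ¬LeftMinimal S y (d + 1) (slinkNode S ord u v)
  excess_le : excess ord s ≤ 2 * S.len + ord.length * (levels ord + 2)
  idle_le : brk = true → s.idle ≤ totalDemotes ord s

theorem LoopInv.le_len_succ (h : LoopInv S y ord brk s) (hu : HasTopKey S (nodeKey ord s) u d) :
    d ≤ S.len + 1 := by
  have := h.demotes_add_key_le u hu.isNode
  rw [hu.key_eq] at this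
  omega

theorem LoopInv.skipStep (ho : IsLevelOrder S ord) (h : LoopInv S y ord brk s)
    (hu : HasTopKey S (nodeKey ord s) u d)
    (hstep : SkipStep S y ord brk u d (record ord u d (report S ord u d s.tick.tick)) s') :
    LoopInv S y ord brk s' := by
  have hd := h.le_len_succ hu
  rw [record_report_eq] at hstep
  have hkey : ∀ w, IsNode S w → nodeKey ord s' w = skipKey S y (nodeKey ord s) u d w :=
    hstep.key_eq
  refine
    { isHeap := hstep.isHeap h.isHeap
      isScanned := hstep.isScanned
        ⟨h.isScanned.isGreatest, h.isScanned.rank_le, h.isScanned.rank_last⟩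
      keyInv := h.keyInv.skip hu hkey
      recordInv := h.recordInv.skip h.keyInv hu hd hkey fun p w hw => ?_
      demotes_add_key_le := fun w hw =>
        (hstep.demotes_add_key_le w hw).trans (h.demotes_add_key_le w hw)
      mem_out := fun T e => ?_
      excess_le := ?_
      idle_le := fun hbrk => ?_ }
  · rw [hstep.leftMinimal]
    exact leftMinimal_record ((ho.mem_iff u).2 hu.isNode) ((ho.mem_iff w).2 hw) d p s
  · have hreport := mem_out_report_iff_leftMinimal (s := s.tick.tick) (T := T) (e := e) ho
      h.keyInv h.recordInv hu
    rw [hstep.out]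
    refine hreport.trans ((or_congr_left (h.mem_out T e)).trans ⟨?_, ?_⟩)
    · rintro (⟨w, v, hw, hv, hT, hE, hlink⟩ | ⟨rfl, v, hv, hT, hlink⟩)
      · exact ⟨w, v, hw, hv, hT,
          (h.keyInv.extracted_skip_iff hu hd hkey hw).2 (Or.inl hE), hlink⟩
      · exact ⟨u, v, hu.isNode, hv, hT,
          (h.keyInv.extracted_skip_iff hu hd hkey hu.isNode).2 (Or.inr ⟨rfl, rfl⟩), hlink⟩
    · rintro ⟨w, v, hw, hv, hT, hE, hlink⟩
      rcases (h.keyInv.extracted_skip_iff hu hd hkey hw).1 hE with hE' | ⟨rfl, rfl⟩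
      · exact Or.inl ⟨w, v, hw, hv, hT, hE', hlink⟩
      · exact Or.inr ⟨rfl, v, hv, hT, hlink⟩
  · refine hstep.excess_le.trans (le_trans (le_of_eq ?_) h.excess_le)
    simp only [excess, totalDemotes, Store.tick]
    push_cast
    ring
  · exact (hstep.idle_le hbrk).trans
      ((Nat.succ_le_succ (h.idle_le hbrk)).trans hstep.totalDemotes_lt)

theorem LoopInv.iteration (ho : IsLevelOrder S ord) (h : LoopInv S y ord brk s)
    (hneg : s.allNegative = false) :
    LoopInv S y ord brk (ColoredStrings.iteration S ord brk s.tick) ∧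
      totalDemotes ord s < totalDemotes ord (ColoredStrings.iteration S ord brk s.tick) := by
  obtain ⟨u, d, hu, hmax⟩ := exists_hasTopKey ho h.isHeap hneg
  have hs : IsScanned S y (2 * S.len) (record ord u d (report S ord u d s.tick.tick)) := by
    rw [record_report_eq]
    exact ⟨h.isScanned.isGreatest, h.isScanned.rank_le, h.isScanned.rank_last⟩
  have hkey : nodeKey ord (record ord u d (report S ord u d s.tick.tick)) = nodeKey ord s := by
    rw [record_report_eq]
    rfl
  have hstep := skipStep_updateAncestors_hProc ho brk hs (hkey ▸ h.keyInv) (hkey ▸ hu)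
    (h.le_len_succ hu)
  have hdemotes : totalDemotes ord (record ord u d (report S ord u d s.tick.tick)) =
      totalDemotes ord s := by
    rw [record_report_eq]
    rfl
  rw [iteration_eq (s := s.tick) ho hu.isNode hmax]
  exact ⟨h.skipStep ho hu hstep, hdemotes ▸ hstep.totalDemotes_lt⟩

theorem LoopInv.nodeDemotes_le (h : LoopInv S y ord brk s) (hw : IsNode S w) :
    nodeDemotes ord s w ≤ S.len + 2 := by
  have := h.demotes_add_key_le w hw
  have := h.keyInv.neg_one_le w hw
  omega

theorem LoopInv.totalDemotes_le (ho : IsLevelOrder S ord) (h : LoopInv S y ord brk s) :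
    totalDemotes ord s ≤ ord.length * (S.len + 2) := by
  refine (Finset.sum_le_card_nsmul _ _ (S.len + 2) fun i hi => ?_).trans_eq
    (by rw [Finset.card_range, smul_eq_mul])
  have hi' := Finset.mem_range.1 hi
  have := h.nodeDemotes_le ((ho.mem_iff _).1 (nodeOf_mem hi'))
  rwa [nodeDemotes, iBFS_nodeOf ho.nodup hi'] at this

theorem LoopInv.exists_while (ho : IsLevelOrder S ord) (h : LoopInv S y ord brk s) :
    ∃ t : Store α, While S ord brk s t.tick ∧ LoopInv S y ord brk t ∧ t.allNegative = true := by
  induction hN : ord.length * (S.len + 2) - totalDemotes ord s using Nat.strong_induction_on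
    generalizing s with
  | _ N ih =>
    cases hneg : s.allNegative with
    | true => exact ⟨s, While.done s hneg, h, hneg⟩
    | false =>
      obtain ⟨h', hlt⟩ := h.iteration ho hneg
      have hle := h'.totalDemotes_le ho
      obtain ⟨t, ht, htinv⟩ := ih _ (by omega) h' rfl
      exact ⟨t, While.next s _ hneg ht, htinv⟩

theorem LoopInv.mem_out_iff (ho : IsLevelOrder S ord) (h : LoopInv S y ord brk s)
    (hneg : s.allNegative = true) (T : List α) (d : ℕ) :
    (T, d) ∈ s.out ↔ T ≠ [] ∧ d ≤ S.len ∧ IsMinUnique S y d T := by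
  rw [h.mem_out]
  constructor
  · rintro ⟨u, v, hu, hv, hT, hE, hlink⟩
    exact isMinUnique_of_leftMinimal ho hu hv hT hE.leftMinimal hlink
  · rintro ⟨hT, hd, hmin⟩
    obtain ⟨u, v, hu, hv, hT', hleft, hlink⟩ := exists_leftMinimal_of_isMinUnique ho hT hmin
    have hkey := key_neg_of_allNegative h.isHeap hneg ((ho.mem_iff u).2 hu)
    exact ⟨u, v, hu, hv, hT',
      ⟨hd.trans (Nat.le_succ _), hleft, hkey.trans_le (Int.natCast_nonneg d)⟩, hlink⟩

end MainLoop

section Start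

variable {α : Type*} [DecidableEq α] {ord : List (Node α)} {u : Node α}

theorem foldl_insert_eq (ord l : List (Node α)) (k : ℤ) (s : Store α) :
    let t := l.foldl (fun s u => s.tick.insert (levels ord) (iBFS ord u) k) s
    t = { s with key := t.key, win := t.win, time := s.time + l.length * (levels ord + 2) } := by
  induction l using List.reverseRecOn with
  | nil => simp only [List.foldl_nil, List.length_nil, zero_mul, add_zero]
  | append_singleton l u ih =>
    simp only [List.foldl_append, List.foldl_cons, List.foldl_nil, Store.insert] at ih ⊢
    rw [setKey_eq, ih]
    simp only [Store.tick, List.length_append, List.length_singleton, Store.mk.injEq, true_and]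
    ring

theorem isHeap_foldl_insert (k : ℤ) {s : Store α} (hs : ∀ i, s.win i = none) {l : List (Node α)}
    (hl : ∀ u ∈ l, u ∈ ord) :
    let t := l.foldl (fun s u => s.tick.insert (levels ord) (iBFS ord u) k) s
    IsHeap (levels ord) {i | ∃ u ∈ l, iBFS ord u = i} t.key t.win := by
  induction l using List.reverseRecOn with
  | nil =>
    intro t z _ _
    simp [t, hs, IsBest]
  | append_singleton l u ih =>
    simp only [List.foldl_append, List.foldl_cons, List.foldl_nil, Store.insert] at ih ⊢
    have hu := (iBFS_lt (hl u (by simp))).trans_le (length_le_two_pow_levels ord)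
    convert IsHeap.setKey (s := Store.tick _) (k := k)
      (ih fun w hw => hl w (List.mem_append_left _ hw)) hu using 1
    ext i
    simp only [List.mem_append, List.mem_singleton, or_and_right, exists_or, exists_eq_left,
      Set.mem_ofPred_eq, Set.mem_insert_iff]
    rw [or_comm, eq_comm]

theorem key_foldl_insert (k : ℤ) (s : Store α) {l : List (Node α)} (hu : u ∈ l) :
    (l.foldl (fun s u => s.tick.insert (levels ord) (iBFS ord u) k) s).key (iBFS ord u) = k := by
  induction l using List.reverseRecOn with
  | nil => cases hu
  | append_singleton l w ih =>
    simp only [List.foldl_append, List.foldl_cons, List.foldl_nil, Store.insert]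
    rw [setKey_eq]
    simp only [Function.update_apply, Store.tick]
    split_ifs with hindex
    · rfl
    · refine ih ((List.mem_append.1 hu).resolve_right fun h => hindex ?_)
      rw [List.mem_singleton.1 h]

variable {γ : Type*} [DecidableEq γ] {S : ColoredString α γ} {y : γ}

theorem start_eq : (start S y ord : Store α) = { (Store.empty : Store α) with
    key := (start S y ord).key
    win := (start S y ord).win
    rank := (Store.preprocess S y (Store.empty : Store α)).rank
    select := (Store.preprocess S y (Store.empty : Store α)).select
    ones := (Store.preprocess S y (Store.empty : Store α)).ones
    time := 2 * S.len + ord.length * (levels ord + 2) } := by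
  have hpre := preprocess_eq (S := S) (y := y) (Store.empty : Store α)
  refine (foldl_insert_eq ord ord _ _).trans ((Store.mk.injEq ..).mpr
    ⟨rfl, rfl, rfl, rfl, rfl, (congrArg Store.leftMinimal hpre :), (congrArg Store.out hpre :),
      (congrArg Store.demotes hpre :), (congrArg Store.idle hpre :), ?_⟩)
  rw [congrArg Store.time hpre]
  simp only [Store.empty, zero_add]

theorem isHeap_start (ho : ord.Nodup) :
    IsHeap (levels ord) (Set.Iio ord.length) (start S y ord).key (start S y ord).win := by
  have hindices : {i | ∃ u ∈ ord, iBFS ord u = i} = Set.Iio ord.length := by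
    ext i
    constructor
    · rintro ⟨u, hu, rfl⟩
      exact iBFS_lt hu
    · exact fun hi => ⟨_, nodeOf_mem hi, iBFS_nodeOf ho hi⟩
  refine hindices ▸ isHeap_foldl_insert _ (fun i => ?_) fun u hu => hu
  rw [preprocess_eq]
  rfl

theorem loopInv_start (ho : IsLevelOrder S ord) (brk : Bool) :
    LoopInv S y ord brk (start S y ord) := by
  have hkey : ∀ w, IsNode S w → nodeKey ord (start S y ord) w = (S.len + 1 : ℕ) :=
    fun w hw => key_foldl_insert _ _ ((ho.mem_iff w).2 hw)
  have hE : ∀ w d, IsNode S w → ¬Extracted S y (nodeKey ord (start S y ord)) w d := by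
    intro w d hw hE
    have := hE.le_len_succ
    have := hE.key_lt
    rw [hkey w hw] at this
    omega
  have hscan := isScanned_preprocess (α := α) (S := S) (y := y)
  refine
    { isHeap := isHeap_start ho.nodup
      isScanned := ?_
      keyInv := keyInv_of_forall_eq S.len.lt_succ_self hkey
      recordInv := ?_
      demotes_add_key_le := fun w hw => ?_
      mem_out := fun T d => ?_
      excess_le := ?_
      idle_le := fun _ => ?_ }
  · rw [start_eq]
    exact ⟨hscan.isGreatest, hscan.rank_le, hscan.rank_last⟩
  · refine recordInv_of_forall_eq_none (fun w d hw => hE w d hw) fun p w => ?_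
    rw [start_eq]
    rfl
  · rw [hkey w hw, nodeDemotes, start_eq]
    simp [Store.empty]
  · have hout : (start S y ord).out = [] := by rw [start_eq]; rfl
    rw [hout]
    refine iff_of_false List.not_mem_nil ?_
    rintro ⟨u, v, hu, -, -, hEu, -⟩
    exact hE u d hu hEu
  · rw [start_eq]
    simp [excess, totalDemotes, Store.empty]
  · rw [start_eq]
    exact Nat.zero_le _

end Start

/-! ### Running time -/

section NodeCount

variable {β : Type*}

/-- The strings at which the trie of the strings in `l` branches. -/
def branching (l : List (List β)) : Set (List β) :=
  {u | ∃ a b, a ≠ b ∧ (∃ t ∈ l, u ++ [a] <+: t) ∧ ∃ t ∈ l, u ++ [b] <+: t}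

theorem exists_prefix_of_mem_branching_cons_diff {s u : List β} {l : List (List β)}
    (hu : u ∈ branching (s :: l) \ branching l) :
    ∃ a b, a ≠ b ∧ u ++ [a] <+: s ∧ ∃ t ∈ l, u ++ [b] <+: t := by
  obtain ⟨⟨a, b, hab, ⟨t, ht, hat⟩, t', ht', hbt⟩, hn⟩ := hu
  rcases List.mem_cons.1 ht with rfl | htl <;> rcases List.mem_cons.1 ht' with rfl | htl'
  · have heq := (List.prefix_of_prefix_length_le hat hbt (by simp)).eq_of_length (by simp)
    exact absurd (List.singleton_inj.1 (List.append_cancel_left heq)) hab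
  · exact ⟨a, b, hab, hat, t', htl', hbt⟩
  · exact ⟨b, a, hab.symm, hbt, t, htl, hat⟩
  · exact absurd ⟨a, b, hab, ⟨t, htl, hat⟩, t', htl', hbt⟩ hn

theorem subsingleton_branching_cons_diff (s : List β) (l : List (List β)) :
    (branching (s :: l) \ branching l).Subsingleton := by
  have hnlt : ∀ u ∈ branching (s :: l) \ branching l, ∀ w ∈ branching (s :: l) \ branching l,
      ¬u.length < w.length := by
    intro u hu w hw hlt
    obtain ⟨a, b, hab, hus, hub⟩ := exists_prefix_of_mem_branching_cons_diff hu
    obtain ⟨c, d, -, hws, t, ht, hwt⟩ := exists_prefix_of_mem_branching_cons_diff hw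
    have huw : u ++ [a] <+: w := List.prefix_of_prefix_length_le hus
      ((List.prefix_append w [c]).trans hws) (by simpa using hlt)
    exact hu.2 ⟨a, b, hab, ⟨t, ht, huw.trans ((List.prefix_append w [d]).trans hwt)⟩, hub⟩
  intro u hu w hw
  obtain ⟨a, b, -, hus, -⟩ := exists_prefix_of_mem_branching_cons_diff hu
  obtain ⟨c, d, -, hws, -⟩ := exists_prefix_of_mem_branching_cons_diff hw
  have hlength := (not_lt.1 (hnlt w hw u hu)).antisymm (not_lt.1 (hnlt u hu w hw))
  exact (List.prefix_of_prefix_length_le ((List.prefix_append u [a]).trans hus)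
    ((List.prefix_append w [c]).trans hws) hlength.le).eq_of_length hlength

theorem encard_branching_le (l : List (List β)) : (branching l).encard ≤ l.length := by
  induction l with
  | nil =>
    refine (Set.encard_eq_zero.2 (Set.eq_empty_of_forall_notMem ?_)).le
    rintro u ⟨a, b, -, ⟨t, ht, -⟩, -⟩
    exact List.not_mem_nil ht
  | cons s l ih =>
    calc (branching (s :: l)).encard
      _ ≤ (branching l ∪ branching (s :: l) \ branching l).encard :=
        Set.encard_le_encard (by rw [Set.union_sdiff_self]; exact Set.subset_union_right)
      _ ≤ (branching l).encard + (branching (s :: l) \ branching l).encard :=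
        Set.encard_union_le _ _
      _ ≤ l.length + 1 := add_le_add ih
        (Set.encard_le_one_iff_subsingleton.2 (subsingleton_branching_cons_diff s l))
      _ = (s :: l).length := by rw [List.length_cons, Nat.cast_succ]

theorem mem_branching_tails {u x : List β} {a b : β} (hab : a ≠ b) (ha : u ++ [a] <:+: x)
    (hb : u ++ [b] <:+: x) : u ∈ branching x.tails := by
  obtain ⟨s, has, hs⟩ := List.infix_iff_prefix_suffix.1 ha
  obtain ⟨t, hbt, ht⟩ := List.infix_iff_prefix_suffix.1 hb
  exact ⟨a, b, hab, ⟨s, (List.mem_tails _ _).2 hs, has⟩, t, (List.mem_tails _ _).2 ht, hbt⟩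

variable {α γ : Type*} [DecidableEq α] {S : ColoredString α γ} {ord : List (Node α)}

theorem length_le_of_isLevelOrder (ho : IsLevelOrder S ord) : ord.length ≤ 2 * S.len + 4 := by
  have hsub : (ord.toFinset : Set (Node α)) ⊆
      (text S).tails.toFinset ∪ branching (text S).tails := by
    intro u hu
    rcases (ho.mem_iff u).1 (List.mem_toFinset.1 hu) with rfl | h | ⟨a, -, b, -, hab, ha, hb⟩
    · exact Or.inl (by simp)
    · exact Or.inl (by simpa using h.2)
    · exact Or.inr (mem_branching_tails hab ha hb)
  have hlength : (text S).tails.length = S.len + 2 := by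
    rw [List.length_tails, length_text]
  have hcard := (Set.encard_le_encard hsub).trans (Set.encard_union_le _ _)
  rw [Set.encard_coe_eq_coe_finsetCard, Set.encard_coe_eq_coe_finsetCard,
    List.toFinset_card_of_nodup ho.nodup] at hcard
  have hle : (ord.length : ℕ∞) ≤ ((S.len + 2 : ℕ) : ℕ∞) + (S.len + 2 : ℕ) :=
    hcard.trans (add_le_add (Nat.cast_le.2 ((List.toFinset_card_le _).trans_eq hlength))
      ((encard_branching_le _).trans_eq (congrArg _ hlength)))
  have : ord.length ≤ S.len + 2 + (S.len + 2) := by exact_mod_cast hle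
  omega

end NodeCount

section TimeBound

theorem one_le_logb_two {n : ℕ} (hn : 2 ≤ n) : 1 ≤ Real.logb 2 n := by
  rw [Real.le_logb_iff_rpow_le one_lt_two (by positivity), Real.rpow_one]
  exact_mod_cast hn

theorem clog_two_le_mul_logb {n k : ℕ} (hn : 2 ≤ n) (hk : k ≤ 2 * n + 4) :
    (Nat.clog 2 k : ℝ) ≤ 4 * Real.logb 2 n := by
  have hlog := one_le_logb_two hn
  have hkn : k ≤ n ^ 3 := hk.trans (by nlinarith [Nat.pow_le_pow_left hn 2])
  calc (Nat.clog 2 k : ℝ)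
    _ ≤ (Nat.clog 2 (n ^ 3) : ℕ) := Nat.cast_le.2 (Nat.clog_mono_right 2 hkn)
    _ = (⌈3 * Real.logb 2 n⌉₊ : ℕ) := by
      rw [← Real.natCeil_logb_natCast, Nat.cast_pow, Real.logb_pow]
      norm_num
    _ ≤ 3 * Real.logb 2 n + 1 := (Nat.ceil_lt_add_one (by linarith)).le
    _ ≤ 4 * Real.logb 2 n := by linarith

theorem steps_le_mul_log {n k : ℕ} (hn : 2 ≤ n) (hk : k ≤ 2 * n + 4) :
    (2 * n + k * (Nat.clog 2 k + 2) + (Nat.clog 2 k + 7) * (k * (n + 2)) + 1 : ℝ) ≤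
      134 / Real.log 2 * ((n : ℝ) ^ 2 * Real.log n) := by
  have hL := clog_two_le_mul_logb hn hk
  have hn' : (2 : ℝ) ≤ n := by exact_mod_cast hn
  have hk' : (k : ℝ) ≤ 4 * n := by exact_mod_cast (by omega : k ≤ 4 * n)
  have hlog := one_le_logb_two hn
  set x := Real.logb 2 n with hx
  have hsq : 2 * n + 1 ≤ 2 * (n ^ 2 * x) := by
    nlinarith [mul_nonneg (sq_nonneg (n : ℝ)) (sub_nonneg.2 hlog)]
  calc (2 * n + k * (Nat.clog 2 k + 2) + (Nat.clog 2 k + 7) * (k * (n + 2)) + 1 : ℝ)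
    _ ≤ 2 * n + 1 + (Nat.clog 2 k + 7) * (k * (n + 3)) := by
      nlinarith [(Nat.cast_nonneg k : (0 : ℝ) ≤ k)]
    _ ≤ 2 * (n ^ 2 * x) + 11 * x * (4 * n * (3 * n)) := by
      gcongr <;> linarith
    _ = 134 / Real.log 2 * ((n : ℝ) ^ 2 * Real.log n) := by
      rw [hx, Real.logb]
      ring

variable {α γ : Type*} [DecidableEq α] [DecidableEq γ] {S : ColoredString α γ} {y : γ}
  {ord : List (Node α)} {brk : Bool} {s : Store α}

theorem LoopInv.time_le (ho : IsLevelOrder S ord) (h : LoopInv S y ord brk s) :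
    s.time ≤ 2 * S.len + ord.length * (levels ord + 2) +
      (levels ord + 6) * (ord.length * (S.len + 2)) + s.idle := by
  have htime : s.time ≤ 2 * S.len + ord.length * (levels ord + 2) +
      (levels ord + 6) * totalDemotes ord s + s.idle := by
    have := h.excess_le
    unfold excess at this
    zify
    linarith
  exact htime.trans (by gcongr; exact h.totalDemotes_le ho)

theorem LoopInv.time_tick_add_le (ho : IsLevelOrder S ord) (h : LoopInv S y ord brk s)
    (hn : 2 ≤ S.len) :
    (s.tick.time + ord.length * (S.len + 2) : ℝ) ≤
      134 / Real.log 2 * ((S.len : ℝ) ^ 2 * Real.log S.len) + s.idle := by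
  have htime : (s.tick.time : ℝ) ≤ 2 * S.len + ord.length * (levels ord + 2) +
      (levels ord + 6) * (ord.length * (S.len + 2)) + s.idle + 1 := by
    exact_mod_cast Nat.succ_le_succ (h.time_le ho)
  have hsteps := steps_le_mul_log hn (length_le_of_isLevelOrder ho)
  rw [levels] at htime
  linarith

end TimeBound

end ColoredStrings

theorem mainTheorem3 :
    ∃ C : ℝ, ∀ (α : Type*) (γ : Type*) [DecidableEq α] [DecidableEq γ]
      (S : ColoredStrings.ColoredString α γ) (y : γ) (ord : List (ColoredStrings.Node α)),
      ColoredStrings.IsLevelOrder S ord →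
      ∀ brk : Bool, ∃ t : ColoredStrings.Store α,
        ColoredStrings.SkippingEndsIn S y ord brk t ∧
        (∀ (T : List α) (d : ℕ), (T, d) ∈ t.out ↔
          T ≠ [] ∧ d ≤ S.len ∧ ColoredStrings.IsMinUnique S y d T) ∧
        (∀ u : ColoredStrings.Node α, ColoredStrings.IsNode S u →
          t.demotes (ColoredStrings.iBFS ord u) ≤ S.len + 2) ∧
        (2 ≤ S.len →
          (t.time : ℝ) ≤ C * ((S.len : ℝ) ^ 2 * Real.log S.len) + (t.idle : ℝ)) ∧
        (2 ≤ S.len → brk = true →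
          (t.time : ℝ) ≤ C * ((S.len : ℝ) ^ 2 * Real.log S.len)) := by
  refine ⟨134 / Real.log 2, fun α γ _ _ S y ord ho brk => ?_⟩
  obtain ⟨t, ht, h, hneg⟩ := (ColoredStrings.loopInv_start (y := y) ho brk).exists_while ho
  have htime := h.time_tick_add_le ho
  have hout := h.mem_out_iff ho hneg
  refine ⟨t.tick, ht, hout, fun u hu => h.nodeDemotes_le hu, fun hn => ?_, fun hn hbrk => ?_⟩
  · exact (le_add_of_nonneg_right (by positivity)).trans (htime hn)
  · have hidle : (t.idle : ℝ) ≤ ord.length * (S.len + 2) := by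
      exact_mod_cast (h.idle_le hbrk).trans (h.totalDemotes_le ho)
    linarith [htime hn]
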